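/- Let $\mathbb K$ be an algebraically closed field of characteristic $0$ and let $m,n\ge 1$. Let $A_\bullet=(A_1\subset\dots\subset A_m)$ be a chain of subspaces of a finite-dimensional $\mathbb K$-vector space, with $\dim A_i=d_i$, and let $\kappa=(\kappa_{i,j})_{1\le i\le m,\,1\le j\le n}$ be a matrix of integers with $0\le \kappa_{i,j}\le d_i$ and $\kappa_{i,j}\le\kappa_{i',j'}$ whenever $i\le i'$ and $j\le j'$. Let $\mathcal F_{\kappa}(A_\bullet)$ be the closed subvariety of $\prod_{i,j}Grass_{\kappa_{i,j}}(A_i)$ formed by the families $(V_{i,j})$ of subspaces $V_{i,j}\subset A_i$ with $\dim V_{i,j}=\kappa_{i,j}$ and $V_{i,j}\subset V_{i',j'}$ whenever $i\le i'$ and $j\le j'$. Write $\kappa_{\bullet,j}=(\kappa_{1,j},\dots,\kappa_{m,j})$ and $Grass_k(N)=Grass_k(\mathbb K^N)$. For $k_\bullet=(k_1\le\dots\le k_m)$ and $e_\bullet=(e_1\le\dots\le e_m)$ with $k_i\le e_i$, let $\mathcal X_{k_\bullet}(e_\bullet)$ be the Schubert variety of partial flags $V_1\subset\dots\subset V_m$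 of $\mathbb K^{e_m}$ with $\dim V_i=k_i$ and $V_i\subset\mathbb K^{e_i}$ for all $i$, where $\mathbb K^{e_1}\subset\dots\subset\mathbb K^{e_m}$ is the standard partial flag. An algebraic variety $X$ is called an iterated bundle of base $(B_1,\dots,B_r)$, where $B_1,\dots,B_r$ are algebraic varieties, if $r=1$ and $X\cong B_1$, or if $r\ge2$ and there is a (Zariski) locally trivial fiber bundle $X\to B_r$ whose typical fiber is an iterated bundle of base $(B_1,\dots,B_{r-1})$. Then: (a) $\mathcal F_{\kappa}(A_\bullet)$ is an iterated bundle of base $$\big(\mathcal X_{\kappa_{\bullet,1}}(\kappa_{\bullet,2}),\ \dots,\ \mathcal X_{\kappa_{\bullet,n-1}}(\kappa_{\bullet,n}),\ \mathcal X_{\kappa_{\bullet,n}}(d_\bullet)\big).$$ (b) Set $\delta_{1,j}=\kappa_{1,j}$ and $\delta_{i,j}=\kappa_{i,j}-\kappa_{i-1,j}$ for $i\ge2$; set $\varepsilon_{i,n}=d_i-\kappa_{i,n}$ and $\varepsilon_{i,j}=\kappa_{i,j+1}-\kappa_{i,j}$ for $j\le n-1$; and set $\mathcal G_{i,j}=Grass_{\delta_{i,j}}(\delta_{i,j}+\varepsilon_{i,j})$.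 Then $\mathcal F_{\kappa}(A_\bullet)$ is an iterated bundle of base $$\big(\mathcal G_{m,1},\dots,\mathcal G_{1,1},\ \mathcal G_{m,2},\dots,\mathcal G_{1,2},\ \dots,\ \mathcal G_{m,n},\dots,\mathcal G_{1,n}\big).$$ (c) The variety $\mathcal F_{\kappa}(A_\bullet)$ is smooth. -/

import Mathlib

open Filter Topology

universe u v w

noncomputable section

namespace FlagVar

/-! ## Spaces with functions and algebraic varieties

Over an algebraically closed field `K`, algebraic varieties are treated in the classical way: a set of
points with a (Zariski) topology and a sheaf of `K`-valued regular functions. -/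

/-- A space with functions over `K`: a topological space with a sheaf of `K`-valued functions such
that a regular function that does not vanish at a point is nonzero, with regular inverse, near the
point. The sheaf is given through its germs: `reg x` is the algebra of all `f : carrier → K` that are
regular at `x` (only the values of `f` near `x` matter), and the sections over an open set `U` are
the functions on `U` that are regular at every point of `U`. -/
structure Space (K : Type u) [Field K] where
  carrier : Type v
  top : TopologicalSpace carrier
  reg : carrier → Subalgebra K (carrier → K)
  reg_congr : ∀ {x : carrier} {f g : carrier → K}, f ∈ reg x → f =ᶠ[𝓝 x] g → g ∈ reg x
  reg_eventually : ∀ {x : carrier} {f : carrier → K}, f ∈ reg x → ∀ᶠ y in 𝓝 x, f ∈ reg y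
  reg_ne_zero : ∀ {x : carrier} {f : carrier → K}, f ∈ reg x → f x ≠ 0 → ∀ᶠ y in 𝓝 x, f y ≠ 0
  reg_inv : ∀ {x : carrier} {f : carrier → K}, f ∈ reg x → f x ≠ 0 → f⁻¹ ∈ reg x

instance {K : Type u} [Field K] : CoeSort (Space.{u, v} K) (Type v) := ⟨Space.carrier⟩

instance {K : Type u} [Field K] (X : Space.{u, v} K) : TopologicalSpace X := X.top

variable {K : Type u} [Field K]

/-- Morphisms: continuous maps that pull regular functions back to regular functions. -/
def IsMorphism (X : Space.{u, v} K) (Y : Space.{u, w} K) (φ : X → Y) : Prop :=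
  Continuous φ ∧ ∀ x : X, ∀ f ∈ Y.reg (φ x), f ∘ φ ∈ X.reg x

/-- Bijections that are morphisms in both directions. -/
def IsIso (X : Space.{u, v} K) (Y : Space.{u, w} K) (e : X ≃ Y) : Prop :=
  IsMorphism X Y e ∧ IsMorphism Y X e.symm

/-- The two spaces with functions are isomorphic. -/
def Isomorphic (X : Space.{u, v} K) (Y : Space.{u, w} K) : Prop :=
  ∃ e : X ≃ Y, IsIso X Y e

/-- The induced structure on a subset: induced topology, and the regular functions are locally the
restrictions of regular functions of the ambient space. -/
def Space.sub (X : Space.{u, v} K) (S : Set X) : Space.{u, v} K where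
  carrier := S
  top := inferInstance
  reg s :=
    { carrier := {f | ∃ g ∈ X.reg (s : X), f =ᶠ[𝓝 s] fun t : S => g t}
      mul_mem' := by
        rintro a b ⟨g, hg, h1⟩ ⟨g', hg', h2⟩
        exact ⟨g * g', mul_mem hg hg', h1.mul h2⟩
      add_mem' := by
        rintro a b ⟨g, hg, h1⟩ ⟨g', hg', h2⟩
        exact ⟨g + g', add_mem hg hg', h1.add h2⟩
      algebraMap_mem' := fun r => ⟨algebraMap K _ r, Subalgebra.algebraMap_mem _ r, by rfl⟩ }
  reg_congr := by
    rintro x f f' ⟨g, hg, h1⟩ h2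
    exact ⟨g, hg, h2.symm.trans h1⟩
  reg_eventually := by
    rintro x f ⟨g, hg, h1⟩
    have h3 : ∀ᶠ y : S in 𝓝 x, g ∈ X.reg (y : X) :=
      continuous_subtype_val.continuousAt.eventually (X.reg_eventually hg)
    filter_upwards [h3, eventually_eventually_nhds.2 h1] with y hy hy'
    exact ⟨g, hy, hy'⟩
  reg_ne_zero := by
    rintro x f ⟨g, hg, h1⟩ h0
    have h2 : g (x : X) ≠ 0 := by rw [h1.eq_of_nhds] at h0; exact h0
    have h3 : ∀ᶠ y : S in 𝓝 x, g (y : X) ≠ 0 :=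
      continuous_subtype_val.continuousAt.eventually (X.reg_ne_zero hg h2)
    filter_upwards [h3, h1] with y hy hy'
    rw [hy']; exact hy
  reg_inv := by
    rintro x f ⟨g, hg, h1⟩ h0
    have h2 : g (x : X) ≠ 0 := by rw [h1.eq_of_nhds] at h0; exact h0
    refine ⟨g⁻¹, X.reg_inv hg h2, ?_⟩
    filter_upwards [h1] with y hy
    simp [hy]

/-- Quotient structure along `π : X → Y`: a set is open iff its preimage is open, and a function on an
open set is regular iff its pull-back is regular on the preimage. -/
def Space.quot (X : Space.{u, v} K) {Y : Type w} (π : X → Y) : Space.{u, w} K :=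
  letI T : TopologicalSpace Y := TopologicalSpace.coinduced π X.top
  { carrier := Y
    top := T
    reg := fun y =>
      { carrier := {f | ∃ U : Set Y, IsOpen U ∧ y ∈ U ∧ ∀ x : X, π x ∈ U → f ∘ π ∈ X.reg x}
        mul_mem' := by
          rintro a b ⟨U, hU, hy, h1⟩ ⟨V, hV, hy', h2⟩
          exact ⟨U ∩ V, hU.inter hV, ⟨hy, hy'⟩, fun x hx => mul_mem (h1 x hx.1) (h2 x hx.2)⟩
        add_mem' := by
          rintro a b ⟨U, hU, hy, h1⟩ ⟨V, hV, hy', h2⟩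
          exact ⟨U ∩ V, hU.inter hV, ⟨hy, hy'⟩, fun x hx => add_mem (h1 x hx.1) (h2 x hx.2)⟩
        algebraMap_mem' := fun r =>
          ⟨Set.univ, isOpen_univ, trivial, fun x _ => Subalgebra.algebraMap_mem (X.reg x) r⟩ }
    reg_congr := by
      rintro y f g ⟨U, hU, hy, h1⟩ h2
      obtain ⟨V, hV, hVo, hyV⟩ := eventually_nhds_iff.1 h2
      refine ⟨U ∩ V, hU.inter hVo, ⟨hy, hyV⟩, fun x hx => X.reg_congr (h1 x hx.1) ?_⟩
      have hc : Continuous π := continuous_coinduced_rng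
      filter_upwards [(hVo.preimage hc).mem_nhds hx.2] with z hz
      exact hV _ hz
    reg_eventually := by
      rintro y f ⟨U, hU, hy, h1⟩
      filter_upwards [hU.mem_nhds hy] with z hz
      exact ⟨U, hU, hz, h1⟩
    reg_ne_zero := by
      rintro y f ⟨U, hU, hy, h1⟩ h0
      have hc : Continuous π := continuous_coinduced_rng
      have ho : IsOpen (U ∩ {z | f z ≠ 0}) := by
        refine isOpen_coinduced.2 (isOpen_iff_mem_nhds.2 ?_)
        rintro x ⟨hx, hx0⟩
        exact inter_mem ((hU.preimage hc).mem_nhds hx) (X.reg_ne_zero (h1 x hx) hx0)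
      filter_upwards [ho.mem_nhds ⟨hy, h0⟩] with z hz
      exact hz.2
    reg_inv := by
      rintro y f ⟨U, hU, hy, h1⟩ h0
      have hc : Continuous π := continuous_coinduced_rng
      have ho : IsOpen (U ∩ {z | f z ≠ 0}) := by
        refine isOpen_coinduced.2 (isOpen_iff_mem_nhds.2 ?_)
        rintro x ⟨hx, hx0⟩
        exact inter_mem ((hU.preimage hc).mem_nhds hx) (X.reg_ne_zero (h1 x hx) hx0)
      exact ⟨_, ho, ⟨hy, h0⟩, fun x hx => X.reg_inv (h1 x hx.1) hx.2⟩ }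

/-- The space with functions generated by algebras `alg z` of functions "polynomial at `z`" on a
topological space `Z`: the basic open sets are the loci `h ≠ 0` in open sets `O` of `Z`, with `h`
polynomial at the points of `O`, and the regular functions are locally the fractions `p / q`. -/
def Space.generate (Z : Type w) [T : TopologicalSpace Z] (alg : Z → Subalgebra K (Z → K))
    (halg : ∀ z, ∀ h ∈ alg z, ∀ᶠ z' in 𝓝 z, h ∈ alg z') : Space.{u, w} K :=
  letI T' : TopologicalSpace Z :=
    { IsOpen := fun U => ∀ z ∈ U, ∃ O : Set Z, IsOpen[T] O ∧ z ∈ O ∧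
        ∃ h ∈ alg z, h z ≠ 0 ∧ ∀ z' ∈ O, h z' ≠ 0 → z' ∈ U
      isOpen_univ := fun z _ => ⟨Set.univ, T.isOpen_univ, trivial, 1, one_mem _, one_ne_zero,
        fun _ _ _ => trivial⟩
      isOpen_inter := by
        rintro U V hU hV z ⟨hzU, hzV⟩
        obtain ⟨O, hO, hzO, h, hh, h0, hs⟩ := hU z hzU
        obtain ⟨O', hO', hzO', h', hh', h0', hs'⟩ := hV z hzV
        exact ⟨O ∩ O', T.isOpen_inter _ _ hO hO', ⟨hzO, hzO'⟩, h * h', mul_mem hh hh',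
          mul_ne_zero h0 h0', fun z' hz' hne =>
            ⟨hs z' hz'.1 (left_ne_zero_of_mul hne), hs' z' hz'.2 (right_ne_zero_of_mul hne)⟩⟩
      isOpen_sUnion := by
        rintro S hS z ⟨U, hU, hz⟩
        obtain ⟨O, hO, hzO, h, hh, h0, hs⟩ := hS U hU z hz
        exact ⟨O, hO, hzO, h, hh, h0, fun z' hz' hne => ⟨U, hU, hs z' hz' hne⟩⟩ }
  have hle : T' ≤ T := fun U hU z hz =>
    ⟨U, hU, hz, 1, one_mem _, one_ne_zero, fun _ h _ => h⟩
  have hne : ∀ z, ∀ h ∈ alg z, h z ≠ 0 → ∀ᶠ z' in @nhds Z T' z, h z' ≠ 0 := by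
    intro z h hh h0
    obtain ⟨O, hO, hOo, hzO⟩ := (@eventually_nhds_iff Z T _ _).1 (halg z h hh)
    refine (@eventually_nhds_iff Z T' _ _).2 ⟨{z' ∈ O | h z' ≠ 0}, fun _ hy => hy.2, ?_, hzO, h0⟩
    exact fun z' hz' => ⟨O, hOo, hz'.1, h, hO _ hz'.1, hz'.2, fun y hy hy0 => ⟨hy, hy0⟩⟩
  { carrier := Z
    top := T'
    reg := fun z =>
      { carrier := {f | ∃ p ∈ alg z, ∃ q ∈ alg z, q z ≠ 0 ∧
          ∀ᶠ z' in @nhds Z T' z, f z' = p z' / q z'}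
        mul_mem' := by
          rintro a b ⟨p, hp, q, hq, h0, h1⟩ ⟨p', hp', q', hq', h0', h1'⟩
          refine ⟨p * p', mul_mem hp hp', q * q', mul_mem hq hq', mul_ne_zero h0 h0', ?_⟩
          filter_upwards [h1, h1'] with y hy hy'
          simp [hy, hy', div_mul_div_comm]
        add_mem' := by
          rintro a b ⟨p, hp, q, hq, h0, h1⟩ ⟨p', hp', q', hq', h0', h1'⟩
          refine ⟨p * q' + q * p', add_mem (mul_mem hp hq') (mul_mem hq hp'), q * q',
            mul_mem hq hq', mul_ne_zero h0 h0', ?_⟩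
          filter_upwards [h1, h1', hne z q hq h0, hne z q' hq' h0'] with y hy hy' hy0 hy0'
          simp [hy, hy', div_add_div _ _ hy0 hy0']
        algebraMap_mem' := fun r => ⟨algebraMap K _ r, Subalgebra.algebraMap_mem _ r, 1,
          one_mem _, one_ne_zero, by simp⟩ }
    reg_congr := by
      rintro z f g ⟨p, hp, q, hq, h0, h1⟩ h2
      refine ⟨p, hp, q, hq, h0, ?_⟩
      filter_upwards [h1, h2] with y hy hy'
      rw [← hy', hy]
    reg_eventually := by
      rintro z f ⟨p, hp, q, hq, h0, h1⟩
      filter_upwards [nhds_mono hle (halg z p hp), nhds_mono hle (halg z q hq), hne z q hq h0,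
        (@eventually_eventually_nhds Z T' _ _).2 h1] with y hy1 hy2 hy3 hy4
      exact ⟨p, hy1, q, hy2, hy3, hy4⟩
    reg_ne_zero := by
      rintro z f ⟨p, hp, q, hq, h0, h1⟩ hf
      have hz := (@Filter.Eventually.self_of_nhds Z T' _ _ h1)
      have hp0 : p z ≠ 0 := by
        intro h; rw [hz, h, zero_div] at hf; exact hf rfl
      filter_upwards [h1, hne z p hp hp0, hne z q hq h0] with y hy hy1 hy2
      rw [hy]; exact div_ne_zero hy1 hy2
    reg_inv := by
      rintro z f ⟨p, hp, q, hq, h0, h1⟩ hf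
      have hz := (@Filter.Eventually.self_of_nhds Z T' _ _ h1)
      have hp0 : p z ≠ 0 := by
        intro h; rw [hz, h, zero_div] at hf; exact hf rfl
      refine ⟨q, hq, p, hp, hp0, ?_⟩
      filter_upwards [h1] with y hy
      simp [hy] }

/-- The polynomial functions on a vector space: the algebra generated by the linear forms. -/
def polyFun (K : Type u) [Field K] (W : Type w) [AddCommGroup W] [Module K W] :
    Subalgebra K (W → K) :=
  Algebra.adjoin K (Set.range fun l : Module.Dual K W => (l : W → K))

/-- A finite-dimensional vector space as an affine space: Zariski topology, and regular functions are
locally fractions of polynomial functions. -/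
def affineSpace (K : Type u) [Field K] (W : Type w) [AddCommGroup W] [Module K W] :
    Space.{u, w} K :=
  Space.generate (T := ⊤) W (fun _ => polyFun K W) fun _ _ hh => Eventually.of_forall fun _ => hh

/-- The product of two spaces with functions (the categorical product): it is generated by the
sums of products `f(x) g(y)` of regular functions. -/
def Space.prod (X : Space.{u, v} K) (Y : Space.{u, w} K) : Space.{u, max v w} K :=
  Space.generate (X × Y)
    (fun z => Algebra.adjoin K ({h | ∃ f ∈ X.reg z.1, h = fun z' => f z'.1} ∪
      {h | ∃ g ∈ Y.reg z.2, h = fun z' => g z'.2}))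
    (by
      intro z h hh
      induction hh using Algebra.adjoin_induction with
      | mem h hh =>
        rcases hh with ⟨f, hf, rfl⟩ | ⟨f, hf, rfl⟩
        · filter_upwards [continuous_fst.continuousAt.eventually (X.reg_eventually hf)] with y hy
          exact Algebra.subset_adjoin (Or.inl ⟨f, hy, rfl⟩)
        · filter_upwards [continuous_snd.continuousAt.eventually (Y.reg_eventually hf)] with y hy
          exact Algebra.subset_adjoin (Or.inr ⟨f, hy, rfl⟩)
      | algebraMap r => exact Eventually.of_forall fun _ => Subalgebra.algebraMap_mem _ r
      | add f g _ _ hf hg => filter_upwards [hf, hg] with y h1 h2 using add_mem h1 h2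
      | mul f g _ _ hf hg => filter_upwards [hf, hg] with y h1 h2 using mul_mem h1 h2)

/-- The product of a (finite) family of spaces with functions. -/
def Space.pi {ι : Type} (X : ι → Space.{u, v} K) : Space.{u, v} K :=
  Space.generate (∀ a, X a)
    (fun z => Algebra.adjoin K {h | ∃ a, ∃ f ∈ (X a).reg (z a), h = fun z' => f (z' a)})
    (by
      intro z h hh
      induction hh using Algebra.adjoin_induction with
      | mem h hh =>
        obtain ⟨a, f, hf, rfl⟩ := hh
        filter_upwards [(continuous_apply a).continuousAt.eventually ((X a).reg_eventually hf)]
          with y hy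
        exact Algebra.subset_adjoin ⟨a, f, hy, rfl⟩
      | algebraMap r => exact Eventually.of_forall fun _ => Subalgebra.algebraMap_mem _ r
      | add f g _ _ hf hg => filter_upwards [hf, hg] with y h1 h2 using add_mem h1 h2
      | mul f g _ _ hf hg => filter_upwards [hf, hg] with y h1 h2 using mul_mem h1 h2)

/-- Isomorphic to a Zariski closed subset of some `K^N`. -/
def Space.IsAffine (X : Space.{u, v} K) : Prop :=
  ∃ (N : ℕ) (Z : Set (affineSpace K (Fin N → K))),
    IsClosed Z ∧ Isomorphic X ((affineSpace K (Fin N → K)).sub Z)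

/-- An algebraic variety (not necessarily irreducible): a finite union of affine open subsets, which
is separated, i.e. has closed diagonal. -/
def Space.IsVariety (X : Space.{u, v} K) : Prop :=
  (∃ 𝒰 : Set (Set X), 𝒰.Finite ∧ ⋃₀ 𝒰 = Set.univ ∧ ∀ U ∈ 𝒰, IsOpen U ∧ (X.sub U).IsAffine) ∧
  IsClosed {z : X.prod X | z.1 = z.2}

/-- The local ring at `x`: germs at `x` of the functions that are regular at `x`. -/
def Space.localRing (X : Space.{u, v} K) (x : X) : Subring (Germ (𝓝 x) K) :=
  (X.reg x).toSubring.map (Germ.coeRingHom (𝓝 x))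

/-- A smooth (nonsingular) variety over an algebraically closed field: a variety all of whose local
rings are regular. -/
def Space.IsSmooth (X : Space.{u, v} K) : Prop :=
  X.IsVariety ∧ ∀ x : X, IsRegularLocalRing (X.localRing x)

/-- `p : X → B` is a (Zariski) locally trivial fiber bundle with typical fiber `F`: the base is
covered by open sets `U` with an isomorphism `p⁻¹(U) ≅ U × F` over `U`. -/
def IsLocallyTrivial (X : Space.{u, v} K) (B : Space.{u, w} K) (F : Space.{u, v} K)
    (p : X → B) : Prop :=
  IsMorphism X B p ∧
  ∀ b : B, ∃ U : Set B, IsOpen U ∧ b ∈ U ∧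
    ∃ e : X.sub (p ⁻¹' U) ≃ (B.sub U).prod F,
      IsIso (X.sub (p ⁻¹' U)) ((B.sub U).prod F) e ∧
      ∀ x : (p ⁻¹' U : Set X), ((e x).1 : U).1 = p x.1

/-- `IsIteratedBundle X [B₁, …, B_r]`: the variety `X` is an iterated bundle of base `(B₁, …, B_r)`.
For `r = 1` this means `X ≅ B₁`; for `r ≥ 2` there is a locally trivial fiber bundle `X → B_r`
whose typical fiber is an iterated bundle of base `(B₁, …, B_{r-1})`. (No `X` is an iterated bundle
of empty base, so that the list `L` below is nonempty.) -/
inductive IsIteratedBundle : Space.{u, v} K → List (Space.{u, w} K) → Prop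
  | iso {X : Space.{u, v} K} {B : Space.{u, w} K} (hX : X.IsVariety) (hB : B.IsVariety)
      (h : Isomorphic X B) : IsIteratedBundle X [B]
  | bundle {X : Space.{u, v} K} {B : Space.{u, w} K} {F : Space.{u, v} K}
      {L : List (Space.{u, w} K)} (hX : X.IsVariety) (hB : B.IsVariety) (p : X → B)
      (hp : IsLocallyTrivial X B F p) (hF : IsIteratedBundle F L) : IsIteratedBundle X (L ++ [B])

/-! ## Grassmannians and flag varieties -/

section Grass

variable (K) (W : Type w) [AddCommGroup W] [Module K W] (k : ℕ)

/-- The variety of `k`-frames of `W`: the (open) set of linearly independent families in `W^k`. -/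
def frames : Space.{u, w} K :=
  (affineSpace K (Fin k → W)).sub {b : Fin k → W | LinearIndependent K b}

/-- The subspace spanned by a frame. -/
def frameSpan (b : frames K W k) : {V : Submodule K W // Module.finrank K V = k} :=
  ⟨Submodule.span K (Set.range b.1), by
    simpa using finrank_span_eq_card (show LinearIndependent K b.1 from b.2)⟩

/-- The Grassmann variety of `k`-dimensional subspaces of `W`, as the quotient of the variety of
`k`-frames by the change of frame (the group `GL_k`). -/
def grass : Space.{u, w} K :=
  (frames K W k).quot (frameSpan K W k)

end Grass

/-- `Grass_k(N) = Grass_k(K^N)`. -/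
abbrev grassN (K : Type u) [Field K] (k N : ℕ) : Space.{u, u} K := grass K (Fin N → K) k

section Flags

variable {A : Type v} [AddCommGroup A] [Module K A] {m n : ℕ}

/-- The doubly indexed flag variety of `A₁ ⊆ … ⊆ A_m` for the matrix `κ`, as a subvariety of the
product of the `Grass_{κ i j}(A_i)`. It has `m + 1` rows and `n + 1` columns here. -/
def doubleFlag (As : Fin (m + 1) → Submodule K A) (κ : Fin (m + 1) → Fin (n + 1) → ℕ) :
    Space.{u, v} K :=
  (Space.pi fun a : Fin (m + 1) × Fin (n + 1) => grass K (As a.1) (κ a.1 a.2)).sub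
    {V : ∀ a : Fin (m + 1) × Fin (n + 1),
        {S : Submodule K (As a.1) // Module.finrank K S = κ a.1 a.2} |
      ∀ i i' j j', i ≤ i' → j ≤ j' →
        (V (i, j)).1.map (As i).subtype ≤ (V (i', j')).1.map (As i').subtype}

/-- The variety of partial flags `V₁ ⊆ … ⊆ V_m` of `A` with dimension vector `k`. -/
def partialFlag (K : Type u) [Field K] (A : Type v) [AddCommGroup A] [Module K A]
    (k : Fin (m + 1) → ℕ) : Space.{u, v} K :=
  (Space.pi fun i : Fin (m + 1) => grass K A (k i)).sub
    {V : ∀ i : Fin (m + 1), {S : Submodule K A // Module.finrank K S = k i} |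
      ∀ i i', i ≤ i' → (V i).1 ≤ (V i').1}

/-- The Schubert variety of the partial flags `V₁ ⊆ … ⊆ V_m` of `A_m` with dimension vector `k` and
`V_i ⊆ A_i` for all `i`. -/
def schubert (As : Fin (m + 1) → Submodule K A) (k : Fin (m + 1) → ℕ) : Space.{u, v} K :=
  (partialFlag K (As (Fin.last m)) k).sub
    {V : {V : ∀ i : Fin (m + 1),
          {S : Submodule K (As (Fin.last m)) // Module.finrank K S = k i} |
        ∀ i i', i ≤ i' → (V i).1 ≤ (V i').1} |
      ∀ i, (V.1 i).1.map (As (Fin.last m)).subtype ≤ As i}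

/-- The standard partial flag `K^{d₁} ⊆ … ⊆ K^{d_m}` in `K^{d_m}`: the `i`-th space consists of the
vectors whose coordinates vanish except possibly the first `d_i`. -/
def stdFlag (K : Type u) [Field K] (d : Fin (m + 1) → ℕ) (i : Fin (m + 1)) :
    Submodule K (Fin (d (Fin.last m)) → K) where
  carrier := {x | ∀ l : Fin (d (Fin.last m)), d i ≤ l.val → x l = 0}
  add_mem' := by
    intro a b ha hb l hl
    simp [ha l hl, hb l hl]
  zero_mem' := fun _ _ => rfl
  smul_mem' := by
    intro c a ha l hl
    simp [ha l hl]

/-- The Schubert variety of the standard partial flag with dimension vector `d`. -/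
abbrev schubertN (K : Type u) [Field K] (k d : Fin (m + 1) → ℕ) : Space.{u, u} K :=
  schubert (stdFlag K d) k

/-- The column after the `j`-th one of the matrix `κ` completed by a last column `d`:
`κ_{•,j+1}` if `j` is not the last column index, and `d` if it is. -/
def nextCol (κ : Fin (m + 1) → Fin (n + 1) → ℕ) (d : Fin (m + 1) → ℕ) (j : Fin (n + 1))
    (i : Fin (m + 1)) : ℕ :=
  if h : j.val + 1 < n + 1 then κ i ⟨j.val + 1, h⟩ else d i

/-- `δ i j = κ i j - κ (i-1) j`, and `δ i j = κ i j` in the first row. -/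
def delta (κ : Fin (m + 1) → Fin (n + 1) → ℕ) (i : Fin (m + 1)) (j : Fin (n + 1)) : ℕ :=
  Fin.cases (motive := fun _ => ℕ) (κ 0 j) (fun i' : Fin m => κ i'.succ j - κ i'.castSucc j) i

/-- `ε i j = κ i (j+1) - κ i j`, and `ε i j = d i - κ i j` in the last column. -/
def epsilon (κ : Fin (m + 1) → Fin (n + 1) → ℕ) (d : Fin (m + 1) → ℕ) (i : Fin (m + 1))
    (j : Fin (n + 1)) : ℕ :=
  nextCol κ d j i - κ i j

end Flags

end FlagVar

end

/-!
The doubly indexed flag variety is completed to a grid of subspaces of `A` with `m + 1` rows and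
`n + 2` columns, in which the last column is the fixed flag `A₁ ⊆ … ⊆ A_m`. So `doubleFlag As κ`
is isomorphic to a variety of monotone families `V : ι → {subspaces of A}` of given dimensions, for
the poset `ι = Fin (m + 1) × Fin (n + 2)`, whose members outside of a set `T` of positions are
prescribed by a fixed family `W` (`monoFamilies W T`, `isomorphic_doubleFlag`).

Forgetting members one after the other gives fibrations. Let `c` be a chain of positions, in `T` or
not, such that the members of a family at the positions `c` form a flag that ranges over a variety
`B` (the members at positions of `c` outside of `T` being constant). The group `GL(A)` acts
transitively on flags of given dimensions, and locally this action has regular sections: over a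
neighbourhood of `b₀` there are automorphisms `g b` of `A`, regular in `b`, that carry the flag of
`b₀` to that of `b` (`exists_local_section`: with projections `p i b` onto the members of the flag of
`b` and a grading of `A` adapted to the flag of `b₀`, the sum of the
`p i b ∘ (i-th graded projection)` is the identity at `b₀`, hence invertible nearby).
Acting by `g b` on the members at positions in `T` only trivializes the map that remembers the
members at `c`, provided that every relation between a position in `T` and one outside of `T` passes
through a position of `c` (`isLocallyTrivial_monoFamilies`). The fibre is the variety
of monotone families with prescribed members outside of `T \ c`, so that the argument iterates
(`isIteratedBundle_tower`), until all members are prescribed and the variety is a point.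

For (a), the stages remove a whole column at a time: the last free column `j` is a flag bounded by
the prescribed column `j + 1`, i.e. a point of a Schubert variety
(`exists_isLocallyTrivial_column`). For (b), they remove one entry at a time, from top to
bottom in the last free column: the entry `(i, j)` lies between the prescribed entries `(i - 1, j)`
and `(i, j + 1)`, so that it is a point of a Grassmannian of their quotient, realized by a
complement (`exists_isLocallyTrivial_entry`). For (c), Grassmannians are locally isomorphic to
affine spaces, a property that passes from base and fibre to the total space of a locally trivial
bundle, and the local rings of affine space are localizations of polynomial rings, hence regular.

The regularity of maps is handled pointwise, by germs: `MorphAt` for maps between spaces with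
functions and `RegMap` for maps into vector spaces. A map into a Grassmannian is regular at a point
if it is locally spanned by a regular frame (`morphAt_of_frame`), and every regular map has such a
frame, the one that is dual to coordinates on which the subspace is transversal (`chartFrame`).
-/

universe v' w' w''

noncomputable section

namespace FlagVar

variable {K : Type u} [Field K]

/-! ### Morphisms at a point -/

/-- `φ` is a morphism at the point `x`: it is continuous at `x` and pulls back germs of regular
functions at `φ x` to germs of regular functions at `x`. The map `φ` is defined everywhere, but the
notion depends only on its values near `x`. -/
def MorphAt (X : Space.{u, v} K) (Y : Space.{u, w} K) (φ : X → Y) (x : X) : Prop :=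
  ContinuousAt φ x ∧ ∀ f ∈ Y.reg (φ x), f ∘ φ ∈ X.reg x

variable {X : Space.{u, v} K} {Y : Space.{u, w} K} {Z : Space.{u, w'} K}

theorem isMorphism_iff {φ : X → Y} : IsMorphism X Y φ ↔ ∀ x, MorphAt X Y φ x :=
  ⟨fun h x => ⟨h.1.continuousAt, h.2 x⟩,
    fun h => ⟨continuous_iff_continuousAt.2 fun x => (h x).1, fun x => (h x).2⟩⟩

theorem morphAt_id (x : X) : MorphAt X X (fun y => y) x := ⟨continuousAt_id, fun _ hf => hf⟩

theorem morphAt_const (y : Y) (x : X) : MorphAt X Y (fun _ => y) x :=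
  ⟨continuousAt_const, fun f _ => Subalgebra.algebraMap_mem (X.reg x) (f y)⟩

theorem MorphAt.comp {φ : X → Y} {ψ : Y → Z} {x : X} (hψ : MorphAt Y Z ψ (φ x))
    (hφ : MorphAt X Y φ x) : MorphAt X Z (fun y => ψ (φ y)) x :=
  ⟨ContinuousAt.comp (f := φ) hψ.1 hφ.1, fun f hf => hφ.2 _ (hψ.2 f hf)⟩

theorem MorphAt.congr {φ ψ : X → Y} {x : X} (h : MorphAt X Y φ x) (e : φ =ᶠ[𝓝 x] ψ) :
    MorphAt X Y ψ x := by
  refine ⟨h.1.congr e, fun f hf => ?_⟩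
  rw [← e.eq_of_nhds] at hf
  exact X.reg_congr (h.2 f hf) (e.fun_comp f)

theorem isIso_iff {e : X ≃ Y} :
    IsIso X Y e ↔ (∀ x, MorphAt X Y e x) ∧ ∀ y, MorphAt Y X e.symm y := by
  rw [IsIso, isMorphism_iff, isMorphism_iff]

theorem IsMorphism.comp {φ : X → Y} {ψ : Y → Z} (hψ : IsMorphism Y Z ψ)
    (hφ : IsMorphism X Y φ) : IsMorphism X Z (fun y => ψ (φ y)) :=
  isMorphism_iff.2 fun x => (isMorphism_iff.1 hψ _).comp (isMorphism_iff.1 hφ x)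

theorem Isomorphic.symm (h : Isomorphic X Y) : Isomorphic Y X := by
  obtain ⟨e, he⟩ := h
  exact ⟨e.symm, he.2, by simpa using he.1⟩

theorem Isomorphic.trans (h : Isomorphic X Y) (h' : Isomorphic Y Z) : Isomorphic X Z := by
  obtain ⟨e, he⟩ := h
  obtain ⟨e', he'⟩ := h'
  exact ⟨e.trans e', he'.1.comp he.1, he.2.comp he'.2⟩

/-! ### Subspaces -/

theorem morphAt_val {S : Set X} (s : X.sub S) : MorphAt (X.sub S) X (fun t : S => (t : X)) s :=
  ⟨continuous_subtype_val.continuousAt, fun f hf => ⟨f, hf, by rfl⟩⟩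

/-- The universal property of the induced structure, at a point. -/
theorem morphAt_sub {S : Set Y} {φ : X → Y.sub S} {x : X}
    (h : MorphAt X Y (fun y => (φ y : S).1) x) : MorphAt X (Y.sub S) φ x := by
  have hc : ContinuousAt φ x := (Topology.IsInducing.subtypeVal (t := S)).continuousAt_iff.2 h.1
  refine ⟨hc, ?_⟩
  rintro f ⟨g, hg, he⟩
  have he' : ∀ᶠ y in 𝓝 x, f (φ y) = g (φ y : S).1 := Tendsto.eventually hc he
  refine X.reg_congr (h.2 g hg) ?_
  filter_upwards [he'] with y hy using hy.symm

/-- A germ of a map with values in `S` is extended arbitrarily to a map into the subspace. -/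
theorem MorphAt.exists_sub {S : Set Y} {φ : X → Y} {x : X} (h : MorphAt X Y φ x)
    (hS : ∀ᶠ y in 𝓝 x, φ y ∈ S) :
    ∃ ψ : X → Y.sub S, MorphAt X (Y.sub S) ψ x ∧ ∀ y, φ y ∈ S → (ψ y : S).1 = φ y := by
  classical
  let ψ : X → Y.sub S := fun y => if hy : φ y ∈ S then ⟨φ y, hy⟩ else ⟨φ x, hS.self_of_nhds⟩
  have hψ : ∀ y, φ y ∈ S → (ψ y : S).1 = φ y := fun y hy => by
    change (dite _ _ _ : S).1 = _
    rw [dif_pos hy]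
  refine ⟨ψ, morphAt_sub (h.congr ?_), hψ⟩
  filter_upwards [hS] with y hy using (hψ y hy).symm

/-! ### Generated structures: affine spaces and products -/

section generate

variable {T : Type v'} [TopologicalSpace T] {alg : T → Subalgebra K (T → K)}
  {halg : ∀ z, ∀ h ∈ alg z, ∀ᶠ z' in 𝓝 z, h ∈ alg z'}

/-- The universal property of the structure generated by algebras of functions, at a point. -/
theorem morphAt_generate {φ : X → T} {x : X} (hc : ContinuousAt φ x)
    (h : ∀ f ∈ alg (φ x), f ∘ φ ∈ X.reg x) :
    MorphAt X (Space.generate T alg halg) φ x := by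
  have hc' : @ContinuousAt X (Space.generate T alg halg) _ _ φ x := by
    intro N hN
    obtain ⟨U, hUN, hU, hxU⟩ := mem_nhds_iff.1 hN
    obtain ⟨O, hO, hzO, g, hg, h0, hs⟩ := hU _ hxU
    have h1 : ∀ᶠ y in 𝓝 x, φ y ∈ O := hc.eventually (hO.mem_nhds hzO)
    have h2 : ∀ᶠ y in 𝓝 x, (g ∘ φ) y ≠ 0 := X.reg_ne_zero (h g hg) h0
    change ∀ᶠ y in 𝓝 x, φ y ∈ N
    filter_upwards [h1, h2] with y hy1 hy2
    exact hUN (hs _ hy1 hy2)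
  refine ⟨hc', ?_⟩
  rintro f ⟨p, hp, q, hq, h0, he⟩
  have h1 : (p ∘ φ) * (q ∘ φ)⁻¹ ∈ X.reg x := mul_mem (h p hp) (X.reg_inv (h q hq) h0)
  refine X.reg_congr h1 ?_
  filter_upwards [hc'.eventually he] with y hy
  exact (div_eq_mul_inv _ _).symm.trans hy.symm

theorem nhds_generate_le (z : T) : @nhds _ (Space.generate T alg halg).top z ≤ 𝓝 z :=
  nhds_mono fun U hU _ hz => ⟨U, hU, hz, 1, one_mem _, one_ne_zero, fun _ h _ => h⟩

theorem continuousAt_generate {φ : T → Y} {z : T} (h : ContinuousAt φ z) :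
    @ContinuousAt (Space.generate T alg halg) Y _ _ φ z :=
  fun _ hN => nhds_generate_le (halg := halg) z (h hN)

theorem mem_reg_generate {z : T} {f : T → K} (hf : f ∈ alg z) :
    f ∈ (Space.generate T alg halg).reg z :=
  ⟨f, hf, 1, one_mem _, one_ne_zero, by simp⟩

end generate

theorem morphAt_fst (z : X.prod Y) : MorphAt (X.prod Y) X (fun z : X × Y => z.1) z := by
  refine ⟨?_, fun f hf => mem_reg_generate (Algebra.subset_adjoin (Or.inl ⟨f, hf, rfl⟩))⟩
  exact continuousAt_generate (T := X × Y) (Y := X) continuous_fst.continuousAt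

theorem morphAt_snd (z : X.prod Y) : MorphAt (X.prod Y) Y (fun z : X × Y => z.2) z := by
  refine ⟨?_, fun f hf => mem_reg_generate (Algebra.subset_adjoin (Or.inr ⟨f, hf, rfl⟩))⟩
  exact continuousAt_generate (T := X × Y) (Y := Y) continuous_snd.continuousAt

theorem morphAt_prod {φ : Z → X.prod Y} {z : Z} (h1 : MorphAt Z X (fun y => (φ y : X × Y).1) z)
    (h2 : MorphAt Z Y (fun y => (φ y : X × Y).2) z) : MorphAt Z (X.prod Y) φ z := by
  refine morphAt_generate (T := X × Y) (φ := φ) (h1.1.prodMk h2.1) fun f hf => ?_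
  induction hf using Algebra.adjoin_induction with
  | mem h hh =>
    rcases hh with ⟨f, hf, rfl⟩ | ⟨f, hf, rfl⟩
    · exact h1.2 f hf
    · exact h2.2 f hf
  | algebraMap r => exact Subalgebra.algebraMap_mem _ r
  | add f g _ _ hf hg => exact add_mem hf hg
  | mul f g _ _ hf hg => exact mul_mem hf hg

section pi

variable {ι : Type} {E : ι → Space.{u, v} K}

theorem morphAt_apply (a : ι) (z : Space.pi E) :
    MorphAt (Space.pi E) (E a) (fun z : ∀ a, E a => z a) z := by
  refine ⟨?_, fun f hf => mem_reg_generate (Algebra.subset_adjoin ⟨a, f, hf, rfl⟩)⟩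
  exact continuousAt_generate (T := ∀ a, E a) (continuous_apply a).continuousAt

theorem morphAt_pi {φ : Z → Space.pi E} {z : Z}
    (h : ∀ a, MorphAt Z (E a) (fun y => (φ y : ∀ a, E a) a) z) : MorphAt Z (Space.pi E) φ z := by
  refine morphAt_generate (T := ∀ a, E a) (φ := φ) (continuousAt_pi.2 fun a => (h a).1)
    fun f hf => ?_
  induction hf using Algebra.adjoin_induction with
  | mem g hg =>
    obtain ⟨a, f, hf, rfl⟩ := hg
    exact (h a).2 f hf
  | algebraMap r => exact Subalgebra.algebraMap_mem _ r
  | add f g _ _ hf hg => exact add_mem hf hg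
  | mul f g _ _ hf hg => exact mul_mem hf hg

end pi

/-! ### Regular vector-valued functions -/

section RegMap

variable {W : Type v'} [AddCommGroup W] [Module K W] {W' : Type w'} [AddCommGroup W'] [Module K W']
  {W'' : Type w''} [AddCommGroup W''] [Module K W'']

/-- The vector-valued function `ψ` is regular at `x`: its composites with linear forms are. -/
def RegMap (X : Space.{u, v} K) (ψ : X → W) (x : X) : Prop :=
  ∀ l : Module.Dual K W, (fun y => l (ψ y)) ∈ X.reg x

theorem morphAt_affineSpace {ψ : X → W} {x : X} :
    MorphAt X (affineSpace K W) ψ x ↔ RegMap X ψ x := by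
  constructor
  · intro h l
    let _ : TopologicalSpace W := ⊤
    exact h.2 l (mem_reg_generate (T := W) (Algebra.subset_adjoin ⟨l, rfl⟩))
  · intro h
    let _ : TopologicalSpace W := ⊤
    refine morphAt_generate (T := W) (φ := ψ)
      (continuous_top.continuousAt) fun f hf => ?_
    induction hf using Algebra.adjoin_induction with
    | mem g hg =>
      obtain ⟨l, rfl⟩ := hg
      exact h l
    | algebraMap r => exact Subalgebra.algebraMap_mem _ r
    | add f g _ _ hf hg => exact add_mem hf hg
    | mul f g _ _ hf hg => exact mul_mem hf hg

theorem regMap_id (w : affineSpace K W) : RegMap (affineSpace K W) (fun w : W => w) w :=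
  morphAt_affineSpace.1 (morphAt_id w)

theorem RegMap.comp {ψ : Y → W} {φ : X → Y} {x : X} (hψ : RegMap Y ψ (φ x))
    (hφ : MorphAt X Y φ x) : RegMap X (fun y => ψ (φ y)) x :=
  fun l => hφ.2 _ (hψ l)

theorem RegMap.congr {ψ ψ' : X → W} {x : X} (h : RegMap X ψ x) (e : ψ =ᶠ[𝓝 x] ψ') :
    RegMap X ψ' x :=
  fun l => X.reg_congr (h l) (e.fun_comp l)

theorem regMap_const (w : W) (x : X) : RegMap X (fun _ => w) x :=
  fun l => Subalgebra.algebraMap_mem (X.reg x) (l w)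

theorem regMap_iff_mem {f : X → K} {x : X} : RegMap X f x ↔ f ∈ X.reg x := by
  refine ⟨fun h => h LinearMap.id, fun h l => ?_⟩
  have : (fun y => l (f y)) = (l 1) • f := by
    ext y
    have := l.map_smul (f y) 1
    simp only [smul_eq_mul, mul_one] at this
    simp [this, mul_comm]
  rw [this]
  exact Subalgebra.smul_mem _ h _

theorem RegMap.add {ψ ψ' : X → W} {x : X} (h : RegMap X ψ x) (h' : RegMap X ψ' x) :
    RegMap X (fun y => ψ y + ψ' y) x := fun l => by
  simp only [map_add]
  exact add_mem (h l) (h' l)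

theorem RegMap.sub {ψ ψ' : X → W} {x : X} (h : RegMap X ψ x) (h' : RegMap X ψ' x) :
    RegMap X (fun y => ψ y - ψ' y) x := fun l => by
  simp only [map_sub]
  exact sub_mem (h l) (h' l)

theorem RegMap.smul {f : X → K} {ψ : X → W} {x : X} (hf : f ∈ X.reg x) (h : RegMap X ψ x) :
    RegMap X (fun y => f y • ψ y) x := fun l => by
  simp only [map_smul, smul_eq_mul]
  exact mul_mem hf (h l)

theorem RegMap.sum {ι : Type*} {s : Finset ι} {ψ : ι → X → W} {x : X}
    (h : ∀ i ∈ s, RegMap X (ψ i) x) : RegMap X (fun y => ∑ i ∈ s, ψ i y) x := fun l => by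
  simp only [map_sum]
  have := sum_mem (S := X.reg x) fun i hi => h i hi l
  convert this using 1
  ext y
  simp

theorem RegMap.linear (f : W →ₗ[K] W') {ψ : X → W} {x : X} (h : RegMap X ψ x) :
    RegMap X (fun y => f (ψ y)) x := fun l => h (l ∘ₗ f)

theorem RegMap.bilinear [FiniteDimensional K W] (B : W →ₗ[K] W' →ₗ[K] W'') {ψ : X → W}
    {ψ' : X → W'} {x : X} (h : RegMap X ψ x) (h' : RegMap X ψ' x) :
    RegMap X (fun y => B (ψ y) (ψ' y)) x := by
  let b := Module.finBasis K W
  have : (fun y => B (ψ y) (ψ' y)) = fun y => ∑ i, b.coord i (ψ y) • B (b i) (ψ' y) := by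
    ext y
    conv_lhs => rw [← b.sum_repr (ψ y)]
    simp only [map_sum, map_smul, LinearMap.sum_apply, LinearMap.smul_apply,
      Module.Basis.coord_apply]
  rw [this]
  exact RegMap.sum fun i _ => (h'.linear (B (b i))).smul (h (b.coord i))

theorem regMap_pi {ι : Type*} [Finite ι] {E : ι → Type*} [∀ i, AddCommGroup (E i)]
    [∀ i, Module K (E i)] {ψ : X → ∀ i, E i} {x : X} :
    RegMap X ψ x ↔ ∀ i, RegMap X (fun y => ψ y i) x := by
  classical
  have := Fintype.ofFinite ι
  refine ⟨fun h i => h.linear (LinearMap.proj i), fun h => ?_⟩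
  have : ψ = fun y => ∑ i, LinearMap.single K E i (ψ y i) := by
    ext y
    simp
  rw [this]
  exact RegMap.sum fun i _ => (h i).linear _

theorem RegMap.eventually [FiniteDimensional K W] {ψ : X → W} {x : X} (h : RegMap X ψ x) :
    ∀ᶠ y in 𝓝 x, RegMap X ψ y := by
  let b := Module.finBasis K W
  have h1 : ∀ᶠ y in 𝓝 x, ∀ i, (fun z => b.coord i (ψ z)) ∈ X.reg y :=
    eventually_all.2 fun i => X.reg_eventually (h (b.coord i))
  filter_upwards [h1] with y hy
  have : ψ = fun z => ∑ i, b.coord i (ψ z) • b i := by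
    ext z
    exact (b.sum_repr (ψ z)).symm
  rw [this]
  exact RegMap.sum fun i _ => (regMap_const (b i) y).smul (hy i)

theorem RegMap.det {n : Type*} [Fintype n] [DecidableEq n] {M : X → Matrix n n K} {x : X}
    (h : ∀ i j, (fun y => M y i j) ∈ X.reg x) : (fun y => (M y).det) ∈ X.reg x := by
  have : (fun y => (M y).det) =
      (Matrix.of fun i j => (⟨fun y => M y i j, h i j⟩ : X.reg x)).det.1 := by
    ext y
    have := RingHom.map_det ((Pi.evalRingHom (fun _ : X => K) y).comp (X.reg x).val.toRingHom)
      (Matrix.of fun i j => (⟨fun y => M y i j, h i j⟩ : X.reg x))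
    refine Eq.trans ?_ this.symm
    rfl
  rw [this]
  exact Subtype.property _

theorem RegMap.matrix_inv {n : Type*} [Fintype n] [DecidableEq n] {M : X → Matrix n n K} {x : X}
    (h : ∀ i j, (fun y => M y i j) ∈ X.reg x) (h0 : (M x).det ≠ 0) (i j : n) :
    (fun y => (M y)⁻¹ i j) ∈ X.reg x := by
  have h1 : (fun y => (M y)⁻¹ i j) = (fun y => (M y).det)⁻¹ * fun y => (M y).adjugate i j := by
    ext y
    simp [Matrix.inv_def, Ring.inverse_eq_inv']
  rw [h1]
  refine mul_mem (X.reg_inv (RegMap.det h) h0) ?_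
  simp only [Matrix.adjugate_apply]
  refine RegMap.det fun i' j' => ?_
  simp only [Matrix.updateRow_apply]
  split_ifs
  · exact Subalgebra.algebraMap_mem (X.reg x) (Pi.single (M := fun _ => K) i 1 j')
  · exact h i' j'

theorem RegMap.ne {ψ : X → W} {x : X} (h : RegMap X ψ x) {w : W} (hw : ψ x ≠ w) :
    ∀ᶠ y in 𝓝 x, ψ y ≠ w := by
  obtain ⟨l, hl⟩ := Module.Projective.exists_dual_ne_zero K (sub_ne_zero.2 hw)
  have h1 := (h.sub (regMap_const w x)) l
  filter_upwards [X.reg_ne_zero h1 hl] with y hy h2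
  exact hy (by simp [h2])

end RegMap

/-! ### Grassmannians -/

section Grass

variable {Z : Space.{u, v} K} {A : Type w} [AddCommGroup A] [Module K A]
  {A' : Type w'} [AddCommGroup A'] [Module K A'] {k k' : ℕ}

/-- The subspace that a point of the Grassmannian stands for. -/
def toSub (V : grass K A k) : Submodule K A :=
  (show {S : Submodule K A // Module.finrank K S = k} from V).1

/-- The point of the Grassmannian given by a subspace. -/
def ofSub (S : Submodule K A) (h : Module.finrank K S = k) : grass K A k :=
  (⟨S, h⟩ : {S : Submodule K A // Module.finrank K S = k})

@[simp] theorem toSub_ofSub (S : Submodule K A) (h : Module.finrank K S = k) :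
    toSub (ofSub S h) = S := rfl

theorem finrank_toSub (V : grass K A k) : Module.finrank K (toSub V) = k :=
  (show {S : Submodule K A // Module.finrank K S = k} from V).2

theorem toSub_injective : Function.Injective (toSub : grass K A k → Submodule K A) :=
  Subtype.val_injective

theorem morphAt_frameSpan (b : frames K A k) :
    MorphAt (frames K A k) (grass K A k) (frameSpan K A k) b := by
  have hc : Continuous[(frames K A k).top, (grass K A k).top] (frameSpan K A k) :=
    continuous_coinduced_rng
  refine ⟨hc.continuousAt, ?_⟩
  rintro f ⟨U, _, hb, h⟩
  exact h b hb

theorem RegMap.coord [FiniteDimensional K A] {ι : Type*} [Finite ι] {ψ : Z → ι → A} {z : Z}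
    (h : RegMap Z ψ z) (π : A →ₗ[K] ι → K) (i j : ι) : (fun y => π (ψ y i) j) ∈ Z.reg z :=
  (regMap_pi.1 h i) (LinearMap.proj j ∘ₗ π)

theorem linearIndependent_of_det_ne_zero {ι : Type*} [Fintype ι] [DecidableEq ι] {b : ι → A}
    (π : A →ₗ[K] ι → K) (h : (Matrix.of fun i j => π (b i) j).det ≠ 0) :
    LinearIndependent K b := by
  have h1 : LinearIndependent K (Matrix.of fun i j => π (b i) j).row :=
    Matrix.linearIndependent_rows_of_det_ne_zero h
  exact LinearIndependent.of_comp π h1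

theorem exists_dual_of_linearIndependent {ι : Type*} [Fintype ι] [DecidableEq ι] {b : ι → A}
    (h : LinearIndependent K b) :
    ∃ π : A →ₗ[K] ι → K, ∀ i, π (b i) = Pi.single i 1 := by
  obtain ⟨π, hπ⟩ := LinearMap.exists_leftInverse_of_injective (Fintype.linearCombination K b)
    (LinearMap.ker_eq_bot.2 (linearIndependent_iff_injective_fintypeLinearCombination.1 h))
  refine ⟨π, fun i => ?_⟩
  have := LinearMap.congr_fun hπ (Pi.single i 1)
  simpa using this

/-- Linear independence is an open condition on a regular family of vectors. -/
theorem RegMap.eventually_linearIndependent [FiniteDimensional K A] {ι : Type*} [Finite ι]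
    {ψ : Z → ι → A} {z : Z} (h : RegMap Z ψ z) (hz : LinearIndependent K (ψ z)) :
    ∀ᶠ y in 𝓝 z, LinearIndependent K (ψ y) := by
  classical
  have := Fintype.ofFinite ι
  obtain ⟨π, hπ⟩ := exists_dual_of_linearIndependent hz
  have h1 : (fun y => (Matrix.of fun i j => π (ψ y i) j).det) ∈ Z.reg z :=
    RegMap.det fun i j => h.coord π i j
  have h2 : (Matrix.of fun i j => π (ψ z i) j).det ≠ 0 := by
    have : (Matrix.of fun i j => π (ψ z i) j) = 1 := by
      ext i j
      simp [hπ, Matrix.one_apply, Pi.single_apply, eq_comm]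
    simp [this]
  filter_upwards [Z.reg_ne_zero h1 h2] with y hy
  exact linearIndependent_of_det_ne_zero π hy

/-- The kernel of `π : A → K^k` is transversal to the subspace `S`. For a fixed `π`, the
`k`-dimensional subspaces with this property form a standard affine chart of the Grassmannian. -/
def Transversal (π : A →ₗ[K] Fin k → K) (S : Submodule K A) : Prop :=
  ∀ x ∈ S, π x = 0 → x = 0

theorem Transversal.bijective [FiniteDimensional K A] {π : A →ₗ[K] Fin k → K} {V : grass K A k}
    (h : Transversal π (toSub V)) : Function.Bijective (π.domRestrict (toSub V)) := by
  have hi : Function.Injective (π.domRestrict (toSub V)) := by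
    refine (injective_iff_map_eq_zero _).2 fun x hx => ?_
    exact Subtype.ext (h x x.2 hx)
  exact ⟨hi, (LinearMap.injective_iff_surjective_of_finrank_eq_finrank
    (by rw [finrank_toSub]; simp)).1 hi⟩

open Classical in
/-- The frame of `V` that `π` maps to the standard basis of `K^k`, for `V` in the chart of `π`
(and the junk value `0` outside of the chart). -/
def chartFrame (π : A →ₗ[K] Fin k → K) (V : grass K A k) (i : Fin k) : A :=
  if h : Function.Bijective (π.domRestrict (toSub V)) then
    ((LinearEquiv.ofBijective _ h).symm (Pi.single i 1) : toSub V) else 0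

section

variable [FiniteDimensional K A] {π : A →ₗ[K] Fin k → K} {V : grass K A k}

omit [FiniteDimensional K A] in
theorem chartFrame_mem (π : A →ₗ[K] Fin k → K) (V : grass K A k) (i : Fin k) :
    chartFrame π V i ∈ toSub V := by
  unfold chartFrame
  split_ifs
  · exact Subtype.property _
  · exact zero_mem _

theorem Transversal.apply_chartFrame (h : Transversal π (toSub V)) (i : Fin k) :
    π (chartFrame π V i) = Pi.single i 1 := by
  rw [chartFrame, dif_pos h.bijective]
  exact (LinearEquiv.ofBijective _ h.bijective).apply_symm_apply _

omit [FiniteDimensional K A] in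
theorem Transversal.eq_of_apply_eq {S : Submodule K A} (h : Transversal π S) {x y : A}
    (hx : x ∈ S) (hy : y ∈ S) (e : π x = π y) : x = y :=
  sub_eq_zero.1 (h _ (sub_mem hx hy) (by simp [e]))

theorem Transversal.linearIndependent_chartFrame (h : Transversal π (toSub V)) :
    LinearIndependent K (chartFrame π V) := by
  refine linearIndependent_of_det_ne_zero π ?_
  have : (Matrix.of fun i j => π (chartFrame π V i) j) = 1 := by
    ext i j
    simp [h.apply_chartFrame, Matrix.one_apply, Pi.single_apply, eq_comm]
  simp [this]

theorem span_eq_toSub {b : Fin k → A} (h : LinearIndependent K b) (hb : ∀ i, b i ∈ toSub V) :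
    Submodule.span K (Set.range b) = toSub V := by
  refine Submodule.eq_of_le_of_finrank_eq (Submodule.span_le.2 (Set.range_subset_iff.2 hb)) ?_
  rw [finrank_span_eq_card h, finrank_toSub, Fintype.card_fin]

theorem Transversal.span_chartFrame (h : Transversal π (toSub V)) :
    Submodule.span K (Set.range (chartFrame π V)) = toSub V :=
  span_eq_toSub h.linearIndependent_chartFrame (chartFrame_mem π V)

omit [FiniteDimensional K A] in
theorem transversal_iff_det {b : Fin k → A} (hb : LinearIndependent K b)
    (hV : Submodule.span K (Set.range b) = toSub V) :
    Transversal π (toSub V) ↔ (Matrix.of fun i j => π (b i) j).det ≠ 0 := by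
  constructor
  · intro h
    refine Matrix.linearIndependent_rows_iff_isUnit.1 ?_ |> (Matrix.isUnit_iff_isUnit_det _).1
      |> IsUnit.ne_zero
    rw [Fintype.linearIndependent_iff] at hb ⊢
    intro g hg
    refine hb g (h _ ?_ ?_)
    · rw [← hV]
      exact sum_mem fun i _ => Submodule.smul_mem _ _ (Submodule.subset_span ⟨i, rfl⟩)
    · rw [map_sum]
      simp only [map_smul]
      exact hg
  · intro h x hx h0
    rw [← hV] at hx
    obtain ⟨g, rfl⟩ := (Submodule.mem_span_range_iff_exists_fun K).1 hx
    have h1 : LinearIndependent K (Matrix.of fun i j => π (b i) j).row :=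
      Matrix.linearIndependent_rows_of_det_ne_zero h
    rw [Fintype.linearIndependent_iff] at h1
    rw [map_sum] at h0
    simp only [map_smul] at h0
    simp [h1 g h0]

/-- Cramer's rule for the chart frame in terms of an arbitrary frame. -/
theorem Transversal.chartFrame_eq (h : Transversal π (toSub V)) {b : Fin k → A}
    (hb : LinearIndependent K b) (hV : Submodule.span K (Set.range b) = toSub V) (i : Fin k) :
    chartFrame π V i = ∑ j, (Matrix.of fun i j => π (b i) j)⁻¹ i j • b j := by
  have hdet := (transversal_iff_det hb hV).1 h
  refine h.eq_of_apply_eq (chartFrame_mem π V i) ?_ ?_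
  · rw [← hV]
    exact sum_mem fun i _ => Submodule.smul_mem _ _ (Submodule.subset_span ⟨i, rfl⟩)
  · rw [h.apply_chartFrame]
    have h1 := Matrix.nonsing_inv_mul (Matrix.of fun i j => π (b i) j) (isUnit_iff_ne_zero.2 hdet)
    ext l
    have h2 := congr_fun (congr_fun h1 i) l
    simp only [Matrix.mul_apply, Matrix.of_apply, Matrix.one_apply] at h2
    simp [h2, Pi.single_apply, eq_comm]

omit [FiniteDimensional K A] in
theorem regMap_frames (b : frames K A k) :
    RegMap (frames K A k) (fun b : {b : Fin k → A | LinearIndependent K b} => b.1) b :=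
  (regMap_id _).comp (morphAt_val (X := affineSpace K (Fin k → A)) b)

theorem reg_det_frames (π : A →ₗ[K] Fin k → K) (b : frames K A k) :
    (fun b : {b : Fin k → A | LinearIndependent K b} =>
      (Matrix.of fun i j => π (b.1 i) j).det) ∈ (frames K A k).reg b :=
  RegMap.det fun i j => (regMap_frames b).coord π i j

theorem isOpen_transversal (π : A →ₗ[K] Fin k → K) :
    IsOpen {V : grass K A k | Transversal π (toSub V)} := by
  refine isOpen_coinduced.2 (isOpen_iff_mem_nhds.2 fun b hb => ?_)
  have h1 := (transversal_iff_det (V := frameSpan K A k b) b.2 rfl).1 hb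
  filter_upwards [(frames K A k).reg_ne_zero (reg_det_frames π b) h1] with b' hb'
  exact (transversal_iff_det (V := frameSpan K A k b') b'.2 rfl).2 hb'

theorem Transversal.regMap_chartFrame (h : Transversal π (toSub V)) :
    RegMap (grass K A k) (chartFrame π) V := by
  refine regMap_pi.2 fun i l => ?_
  refine ⟨_, isOpen_transversal π, h, fun b hb => ?_⟩
  have h1 := (transversal_iff_det (V := frameSpan K A k b) b.2 rfl).1 hb
  have h2 : RegMap (frames K A k) (fun b : {b : Fin k → A | LinearIndependent K b} =>
      ∑ j, (Matrix.of fun i j => π (b.1 i) j)⁻¹ i j • b.1 j) b :=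
    RegMap.sum fun j _ => (regMap_pi.1 (regMap_frames b) j).smul
      (RegMap.matrix_inv (fun i j => (regMap_frames b).coord π i j) h1 i j)
  refine (frames K A k).reg_congr (h2 l) ?_
  filter_upwards [(frames K A k).reg_ne_zero (reg_det_frames π b) h1] with b' hb'
  have h3 := (transversal_iff_det (V := frameSpan K A k b') b'.2 rfl).2 hb'
  exact congr_arg l (h3.chartFrame_eq (V := frameSpan K A k b') b'.2 rfl i).symm

variable (V) in
theorem exists_transversal : ∃ π : A →ₗ[K] Fin k → K, Transversal π (toSub V) := by
  let b := Module.finBasisOfFinrankEq K (toSub V) (finrank_toSub V)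
  obtain ⟨π, hπ⟩ := b.equivFun.toLinearMap.exists_extend
  refine ⟨π, fun x hx h0 => ?_⟩
  have := LinearMap.congr_fun hπ ⟨x, hx⟩
  simp only [LinearMap.comp_apply, Submodule.subtype_apply, h0] at this
  have h1 := b.equivFun.map_eq_zero_iff.1 this.symm
  exact congr_arg Subtype.val h1

/-- The projection of `A` onto `V` along the kernel of `π`. -/
def chartProj (π : A →ₗ[K] Fin k → K) (V : grass K A k) : A →ₗ[K] A :=
  ∑ i, (LinearMap.proj i ∘ₗ π).smulRight (chartFrame π V i)

omit [FiniteDimensional K A] in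
theorem chartProj_mem (π : A →ₗ[K] Fin k → K) (V : grass K A k) (x : A) :
    chartProj π V x ∈ toSub V := by
  simp only [chartProj, LinearMap.sum_apply, LinearMap.smulRight_apply]
  exact sum_mem fun i _ => Submodule.smul_mem _ _ (chartFrame_mem π V i)

theorem Transversal.apply_chartProj (h : Transversal π (toSub V)) (x : A) :
    π (chartProj π V x) = π x := by
  simp only [chartProj, LinearMap.sum_apply, LinearMap.smulRight_apply, map_sum, map_smul,
    h.apply_chartFrame]
  ext j
  simp [Pi.single_apply]

theorem Transversal.chartProj_eq_iff (h : Transversal π (toSub V)) {x : A} :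
    chartProj π V x = x ↔ x ∈ toSub V :=
  ⟨fun e => e ▸ chartProj_mem π V x,
    fun hx => h.eq_of_apply_eq (chartProj_mem π V x) hx (h.apply_chartProj x)⟩

theorem Transversal.regMap_chartProj (h : Transversal π (toSub V)) :
    RegMap (grass K A k) (chartProj π) V := by
  unfold chartProj
  refine RegMap.sum fun i _ => ?_
  have := (regMap_pi.1 h.regMap_chartFrame i).linear
    (LinearMap.smulRightₗ (M₂ := A) (LinearMap.proj i ∘ₗ π))
  exact this

end

variable [FiniteDimensional K A] [FiniteDimensional K A'] {z : Z}

/-- A map to the Grassmannian is a morphism where it is spanned by a regular frame. -/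
theorem morphAt_of_frame {φ : Z → grass K A k} {ψ : Z → Fin k → A} (hψ : RegMap Z ψ z)
    (hli : LinearIndependent K (ψ z))
    (h : ∀ᶠ y in 𝓝 z, Submodule.span K (Set.range (ψ y)) = toSub (φ y)) :
    MorphAt Z (grass K A k) φ z := by
  have h1 := hψ.eventually_linearIndependent hli
  have h2 : ∀ᶠ y in 𝓝 z, ψ y ∈ {b : Fin k → A | LinearIndependent K b} := h1
  obtain ⟨θ, hθ, e⟩ := (morphAt_affineSpace.2 hψ).exists_sub h2
  refine ((morphAt_frameSpan (θ z)).comp hθ).congr ?_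
  filter_upwards [h, h1] with y hy hy1
  refine toSub_injective ((?_ : _ = _).trans hy)
  rw [← e y hy1]
  rfl

/-- A map to the Grassmannian is a morphism where it is spanned by a regular finite family. -/
theorem morphAt_of_span {φ : Z → grass K A k} {ι : Type*} [Finite ι] {ψ : Z → ι → A}
    (hψ : RegMap Z ψ z)
    (h : ∀ᶠ y in 𝓝 z, Submodule.span K (Set.range (ψ y)) = toSub (φ y)) :
    MorphAt Z (grass K A k) φ z := by
  obtain ⟨f, hf, hs, hli⟩ := Submodule.exists_fun_fin_finrank_span_eq K (Set.range (ψ z))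
  have hk : Module.finrank K (Submodule.span K (Set.range (ψ z))) = k := by
    rw [h.self_of_nhds, finrank_toSub]
  choose s hs' using hf
  let t : Fin k → ι := fun i => s (Fin.cast hk.symm i)
  have ht : (fun i => ψ z (t i)) = f ∘ Fin.cast hk.symm := funext fun i => hs' _
  have h1 : RegMap Z (fun y i => ψ y (t i)) z := regMap_pi.2 fun i => regMap_pi.1 hψ (t i)
  have h2 : LinearIndependent K fun i => ψ z (t i) := by
    rw [ht]
    exact hli.comp _ (Fin.cast_injective _)
  refine morphAt_of_frame h1 h2 ?_
  filter_upwards [h, h1.eventually_linearIndependent h2] with y hy hy1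
  exact span_eq_toSub hy1 fun i => hy ▸ Submodule.subset_span ⟨t i, rfl⟩

theorem MorphAt.eventually_transversal {φ : Z → grass K A k} (h : MorphAt Z (grass K A k) φ z)
    {π : A →ₗ[K] Fin k → K} (hπ : Transversal π (toSub (φ z))) :
    ∀ᶠ y in 𝓝 z, Transversal π (toSub (φ y)) :=
  h.1.eventually ((isOpen_transversal π).mem_nhds hπ)

/-- Images under a regularly varying linear map, enlarged by a fixed subspace, vary regularly. -/
theorem MorphAt.map_sup {φ : Z → grass K A k} (h : MorphAt Z (grass K A k) φ z)
    {g : Z → A →ₗ[K] A'} (hg : RegMap Z g z) (L : Submodule K A') {φ' : Z → grass K A' k'}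
    (e : ∀ᶠ y in 𝓝 z, toSub (φ' y) = (toSub (φ y)).map (g y) ⊔ L) :
    MorphAt Z (grass K A' k') φ' z := by
  obtain ⟨π, hπ⟩ := exists_transversal (φ z)
  have h1 := hπ.regMap_chartFrame.comp h
  let b := Module.finBasis K L
  have h2 : RegMap Z (fun y => Sum.elim (fun i => g y (chartFrame π (φ y) i))
      (fun i => (b i : A'))) z := by
    refine regMap_pi.2 ?_
    rintro (i | i)
    · exact RegMap.bilinear LinearMap.id hg (regMap_pi.1 h1 i)
    · exact regMap_const _ _
  refine morphAt_of_span h2 ?_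
  filter_upwards [e, h.eventually_transversal hπ] with y hy hy1
  rw [hy, Set.Sum.elim_range, Submodule.span_union, ← hy1.span_chartFrame, Submodule.map_span]
  congr 1
  · rw [← Set.range_comp]
    rfl
  · have : (Set.range fun i => (b i : A')) = L.subtype '' Set.range b := by
      rw [← Set.range_comp]
      rfl
    rw [this, ← Submodule.map_span, b.span_eq, Submodule.map_top, Submodule.range_subtype]

theorem MorphAt.map {φ : Z → grass K A k} (h : MorphAt Z (grass K A k) φ z)
    (g : A →ₗ[K] A') {φ' : Z → grass K A' k'}
    (e : ∀ᶠ y in 𝓝 z, toSub (φ' y) = (toSub (φ y)).map g) :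
    MorphAt Z (grass K A' k') φ' z :=
  h.map_sup (regMap_const g z) ⊥ (by simpa using e)

/-- Inclusion between varying subspaces is a closed condition: it can fail only in an open set. -/
theorem eventually_not_le {φ : Z → grass K A k} {φ' : Z → grass K A k'}
    (h : MorphAt Z (grass K A k) φ z) (h' : MorphAt Z (grass K A k') φ' z)
    (hz : ¬ toSub (φ z) ≤ toSub (φ' z)) : ∀ᶠ y in 𝓝 z, ¬ toSub (φ y) ≤ toSub (φ' y) := by
  obtain ⟨π, hπ⟩ := exists_transversal (φ z)
  obtain ⟨π', hπ'⟩ := exists_transversal (φ' z)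
  rw [← hπ.span_chartFrame, Submodule.span_le, Set.range_subset_iff, not_forall] at hz
  obtain ⟨i, hi⟩ := hz
  -- the component of a frame vector of `φ y` along the kernel of `π'` is regular and nonzero at `z`
  have h1 : RegMap Z (fun y => chartProj π' (φ' y) (chartFrame π (φ y) i) - chartFrame π (φ y) i)
      z := by
    have h2 := regMap_pi.1 (hπ.regMap_chartFrame.comp h) i
    exact (RegMap.bilinear LinearMap.id (hπ'.regMap_chartProj.comp h') h2).sub h2
  have h0 : chartProj π' (φ' z) (chartFrame π (φ z) i) - chartFrame π (φ z) i ≠ 0 :=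
    fun e => hi (hπ'.chartProj_eq_iff.1 (sub_eq_zero.1 e))
  filter_upwards [h1.ne h0, h'.eventually_transversal hπ'] with y hy hy1 hle
  exact hy (sub_eq_zero.2 (hy1.chartProj_eq_iff.2 (hle (chartFrame_mem π (φ y) i))))

theorem isClosed_le {φ : Z → grass K A k} {φ' : Z → grass K A k'}
    (h : ∀ z, MorphAt Z (grass K A k) φ z) (h' : ∀ z, MorphAt Z (grass K A k') φ' z) :
    IsClosed {z | toSub (φ z) ≤ toSub (φ' z)} :=
  isOpen_compl_iff.1 (isOpen_iff_mem_nhds.2 fun z hz => eventually_not_le (h z) (h' z) hz)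

end Grass

/-! ### Varieties -/

section Variety

variable {X : Space.{u, v} K} {Y : Space.{u, w} K}

/-- An isomorphism restricts to isomorphisms between corresponding subspaces. -/
theorem IsIso.sub {e : X ≃ Y} (he : IsIso X Y e) (S : Set X) :
    Isomorphic (X.sub S) (Y.sub (e.symm ⁻¹' S)) := by
  rw [isIso_iff] at he
  let e' : X.sub S ≃ Y.sub (e.symm ⁻¹' S) :=
    { toFun := fun s => (⟨e (s : S).1, by
        have := (s : S).2
        simpa using this⟩ : (e.symm ⁻¹' S : Set Y))
      invFun := fun s => (⟨e.symm (s : (e.symm ⁻¹' S : Set Y)).1,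
        (s : (e.symm ⁻¹' S : Set Y)).2⟩ : S)
      left_inv := fun s => Subtype.ext (e.symm_apply_apply _)
      right_inv := fun s => Subtype.ext (e.apply_symm_apply _) }
  refine ⟨e', isIso_iff.2 ⟨fun s => morphAt_sub ((he.1 _).comp (morphAt_val s)),
    fun s => morphAt_sub ((he.2 _).comp (morphAt_val s))⟩⟩

theorem Space.IsAffine.of_isomorphic (h : Isomorphic X Y) (hX : X.IsAffine) : Y.IsAffine := by
  obtain ⟨N, Z, hZ, h'⟩ := hX
  exact ⟨N, Z, hZ, h.symm.trans h'⟩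

theorem Space.IsVariety.of_isomorphic (h : Isomorphic X Y) (hX : X.IsVariety) : Y.IsVariety := by
  obtain ⟨e, he⟩ := h
  obtain ⟨⟨𝒰, hfin, hcov, hU⟩, hsep⟩ := hX
  have he' := isIso_iff.1 he
  refine ⟨⟨(fun U => e.symm ⁻¹' U) '' 𝒰, hfin.image _, ?_, ?_⟩, ?_⟩
  · refine Set.eq_univ_of_forall fun y => ?_
    obtain ⟨U, hU, hy⟩ := Set.eq_univ_iff_forall.1 hcov (e.symm y)
    exact ⟨_, ⟨U, hU, rfl⟩, hy⟩
  · rintro _ ⟨U, hU', rfl⟩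
    exact ⟨(hU U hU').1.preimage he.2.1, (hU U hU').2.of_isomorphic (he.sub U)⟩
  · have hm : IsMorphism (Y.prod Y) (X.prod X) (fun z => (e.symm z.1, e.symm z.2)) :=
      isMorphism_iff.2 fun z => morphAt_prod ((he'.2 _).comp (morphAt_fst z))
        ((he'.2 _).comp (morphAt_snd z))
    convert hsep.preimage hm.1 using 1
    ext z
    exact e.symm.injective.eq_iff.symm

theorem isAffine_of_isomorphic_closed {W : Type v'} [AddCommGroup W] [Module K W]
    [FiniteDimensional K W] {Z : Set (affineSpace K W)} (hZ : IsClosed Z)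
    (h : Isomorphic X ((affineSpace K W).sub Z)) : X.IsAffine := by
  let e := (Module.finBasis K W).equivFun
  have he : IsIso (affineSpace K W) (affineSpace K (Fin (Module.finrank K W) → K)) e.toEquiv :=
    isIso_iff.2 ⟨fun w => morphAt_affineSpace.2 ((regMap_id w).linear e.toLinearMap),
      fun w => morphAt_affineSpace.2 ((regMap_id w).linear e.symm.toLinearMap)⟩
  exact ⟨_, _, hZ.preimage he.2.1, h.trans (he.sub Z)⟩

end Variety

section PiGrass

/-- Finitely many coordinate charts cover the Grassmannian. -/
theorem exists_transversal_coord {A : Type w} [AddCommGroup A] [Module K A] [FiniteDimensional K A]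
    {k : ℕ} {ν : Type*} [Finite ν] (b : Module.Basis ν K A) (V : grass K A k) :
    ∃ s : Fin k → ν, Transversal (LinearMap.pi fun i => b.coord (s i)) (toSub V) := by
  let r : Module.Dual K A →ₗ[K] Module.Dual K (toSub V) :=
    Module.Dual.transpose (toSub V).subtype
  have hspan : Submodule.span K (Set.range fun j => r (b.coord j)) = ⊤ := by
    refine eq_top_iff.2 fun l _ => ?_
    obtain ⟨l', hl'⟩ := l.exists_extend
    have h1 : l = r l' := hl'.symm
    have := Fintype.ofFinite ν
    have h2 : l' = ∑ j, l' (b j) • b.coord j := by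
      classical
      refine b.ext fun i => ?_
      simp
    rw [h1, h2, map_sum]
    refine sum_mem fun j _ => ?_
    rw [map_smul]
    exact Submodule.smul_mem _ _ (Submodule.subset_span ⟨j, rfl⟩)
  obtain ⟨f, hf, hs, -⟩ := Submodule.exists_fun_fin_finrank_span_eq K
    (Set.range fun j => r (b.coord j))
  have hk : Module.finrank K (Submodule.span K (Set.range fun j => r (b.coord j))) = k := by
    rw [hspan, finrank_top, Subspace.dual_finrank_eq, finrank_toSub]
  choose s hs' using hf
  refine ⟨fun i => s (Fin.cast hk.symm i), fun x hx h0 => ?_⟩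
  have h1 : ∀ l : Module.Dual K (toSub V), l ⟨x, hx⟩ = 0 := by
    intro l
    have hl : l ∈ Submodule.span K (Set.range f) := by
      rw [hs, hspan]
      trivial
    induction hl using Submodule.span_induction with
    | mem l hl =>
      obtain ⟨i, rfl⟩ := hl
      rw [← hs' i]
      exact congr_fun h0 (Fin.cast hk i)
    | zero => rfl
    | add l l' _ _ h h' => simp [h, h']
    | smul c l _ h => simp [h]
  exact congr_arg Subtype.val ((Module.forall_dual_apply_eq_zero_iff K _).1 h1)

variable {ι : Type} [Finite ι] {E : ι → Type w} [∀ a, AddCommGroup (E a)] [∀ a, Module K (E a)]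
  [∀ a, FiniteDimensional K (E a)] {k : ι → ℕ}

/-- The point of the product of Grassmannians spanned by a family of frames. Where the given
vectors are dependent, it is the junk value `x₀`. -/
def spanPoint (x₀ : ∀ a, grass K (E a) (k a)) (w : ∀ a, Fin (k a) → E a) (a : ι) :
    grass K (E a) (k a) :=
  open Classical in
  if h : LinearIndependent K (w a) then
    ofSub (Submodule.span K (Set.range (w a))) (by rw [finrank_span_eq_card h, Fintype.card_fin])
  else x₀ a

omit [Finite ι] [∀ a, FiniteDimensional K (E a)] in
theorem toSub_spanPoint (x₀ : ∀ a, grass K (E a) (k a)) {w : ∀ a, Fin (k a) → E a} {a : ι}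
    (h : LinearIndependent K (w a)) :
    toSub (spanPoint x₀ w a) = Submodule.span K (Set.range (w a)) := by
  rw [spanPoint, dif_pos h, toSub_ofSub]

omit [Finite ι] in
theorem morphAt_spanPoint (x₀ : ∀ a, grass K (E a) (k a))
    (w : affineSpace K (∀ a, Fin (k a) → E a)) (h : ∀ a, LinearIndependent K (w a)) :
    MorphAt (affineSpace K (∀ a, Fin (k a) → E a)) (Space.pi fun a => grass K (E a) (k a))
      (spanPoint x₀) w := by
  refine morphAt_pi fun a => ?_
  have h1 : RegMap (affineSpace K (∀ a, Fin (k a) → E a)) (fun w => w a) w :=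
    (regMap_id w).linear (LinearMap.proj a)
  refine morphAt_of_frame h1 (h a) ?_
  filter_upwards [h1.eventually_linearIndependent (h a)] with y hy
  exact (toSub_spanPoint x₀ hy).symm

theorem isOpen_transversal_pi (S : Set (Space.pi fun a => grass K (E a) (k a)))
    (π : ∀ a, E a →ₗ[K] Fin (k a) → K) :
    IsOpen {x : (Space.pi fun a => grass K (E a) (k a)).sub S |
      ∀ a, Transversal (π a) (toSub ((x : S).1 a))} := by
  refine isOpen_iff_mem_nhds.2 fun x hx => ?_
  have h1 : ∀ᶠ y in 𝓝 x, ∀ a, Transversal (π a) (toSub ((y : S).1 a)) :=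
    eventually_all.2 fun a =>
      ((morphAt_apply a _).comp (morphAt_val x)).eventually_transversal (hx a)
  exact h1

/-- The intersection of a closed subset of a product of Grassmannians with a product of standard
charts is isomorphic to a closed subset of the affine space of families of matrices. -/
theorem isAffine_transversal_pi {S : Set (Space.pi fun a => grass K (E a) (k a))}
    (hS : IsClosed S) (π : ∀ a, E a →ₗ[K] Fin (k a) → K)
    (x₀ : S) :
    (((Space.pi fun a => grass K (E a) (k a)).sub S).sub
      {x | ∀ a, Transversal (π a) (toSub ((x : S).1 a))}).IsAffine := by
  let P := Space.pi fun a => grass K (E a) (k a)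
  let U : Set (P.sub S) := {x | ∀ a, Transversal (π a) (toSub ((x : S).1 a))}
  let W := ∀ a, Fin (k a) → E a
  let sp : W → P := spanPoint x₀.1
  let Z : Set (affineSpace K W) :=
    {w : W | (∀ a i, π a (w a i) = Pi.single i 1) ∧ sp w ∈ S}
  have hli : ∀ w : W, (∀ a i, π a (w a i) = Pi.single i 1) → ∀ a, LinearIndependent K (w a) := by
    intro w hw a
    refine linearIndependent_of_det_ne_zero (π a) ?_
    have : (Matrix.of fun i j => π a (w a i) j) = 1 := by
      ext i j
      simp [hw, Matrix.one_apply, Pi.single_apply, eq_comm]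
    simp [this]
  have htr : ∀ w : W, (∀ a i, π a (w a i) = Pi.single i 1) →
      ∀ a, Transversal (π a) (toSub (sp w a)) := by
    intro w hw a
    have h1 := toSub_spanPoint x₀.1 (hli w hw a)
    refine (transversal_iff_det (hli w hw a) h1.symm).2 ?_
    have : (Matrix.of fun i j => π a (w a i) j) = 1 := by
      ext i j
      simp [hw, Matrix.one_apply, Pi.single_apply, eq_comm]
    simp [this]
  have hZ : IsClosed Z := by
    refine isOpen_compl_iff.1 (isOpen_iff_mem_nhds.2 fun w hw => ?_)
    by_cases h : ∀ a i, π a ((w : W) a i) = Pi.single i 1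
    · have h1 : sp w ∉ S := fun h' => hw ⟨h, h'⟩
      have h2 : ∀ᶠ w' : affineSpace K W in 𝓝 w, sp w' ∈ Sᶜ :=
        (morphAt_spanPoint x₀.1 w (hli w h)).1.eventually (hS.isOpen_compl.mem_nhds h1)
      filter_upwards [h2] with w' hw' h3 using hw' h3.2
    · push Not at h
      obtain ⟨a, i, h⟩ := h
      have h1 : RegMap (affineSpace K W) (fun w : W => π a (w a i)) w :=
        (regMap_pi.1 (regMap_pi.1 (regMap_id w) a) i).linear (π a)
      filter_upwards [h1.ne h] with w' hw' h3 using hw' (h3.1 a i)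
  refine isAffine_of_isomorphic_closed hZ ?_
  have hsp : ∀ x : U, sp (fun a => chartFrame (π a) ((x.1 : S).1 a)) = (x.1 : S).1 := by
    intro x
    have hx : ∀ a, Transversal (π a) (toSub ((x.1 : S).1 a)) := x.2
    refine funext fun a => toSub_injective ?_
    exact (toSub_spanPoint x₀.1 (w := fun a => chartFrame (π a) ((x.1 : S).1 a))
      (hx a).linearIndependent_chartFrame).trans (hx a).span_chartFrame
  let e : (P.sub S).sub U ≃ (affineSpace K W).sub Z :=
    { toFun := fun x => (⟨fun a => chartFrame (π a) (((x : U).1 : S).1 a),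
        fun a => ((x : U).2 a).apply_chartFrame,
        Set.mem_of_eq_of_mem (hsp x) ((x : U).1 : S).2⟩ : Z)
      invFun := fun w => (⟨(⟨sp (w : Z).1, (w : Z).2.2⟩ : S), htr _ (w : Z).2.1⟩ : U)
      left_inv := fun x => Subtype.ext (Subtype.ext (hsp x))
      right_inv := fun w => Subtype.ext (by
        have h1 := (w : Z).2.1
        funext a i
        refine (htr _ h1 a).eq_of_apply_eq (chartFrame_mem _ _ _) ?_ ?_
        · exact (toSub_spanPoint x₀.1 (hli _ h1 a)).ge (Submodule.subset_span ⟨i, rfl⟩)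
        · exact ((htr _ h1 a).apply_chartFrame i).trans (h1 a i).symm) }
  refine ⟨e, isIso_iff.2 ⟨fun x => ?_, fun w => ?_⟩⟩
  · refine morphAt_sub (morphAt_affineSpace.2 (regMap_pi.2 fun a => ?_))
    exact ((x : U).2 a).regMap_chartFrame.comp
      ((morphAt_apply a _).comp ((morphAt_val _).comp (morphAt_val x)))
  · exact morphAt_sub (morphAt_sub
      ((morphAt_spanPoint x₀.1 _ (hli _ (w : Z).2.1)).comp (morphAt_val w)))

/-- Closed subsets of products of Grassmannians are varieties. -/
theorem isVariety_pi_grass {S : Set (Space.pi fun a => grass K (E a) (k a))}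
    (hS : IsClosed S) : ((Space.pi fun a => grass K (E a) (k a)).sub S).IsVariety := by
  constructor
  · let π : (∀ a, Fin (k a) → Fin (Module.finrank K (E a))) → ∀ a, E a →ₗ[K] Fin (k a) → K :=
      fun s a => LinearMap.pi fun i => (Module.finBasis K (E a)).coord (s a i)
    let U : (∀ a, Fin (k a) → Fin (Module.finrank K (E a))) →
        Set ((Space.pi fun a => grass K (E a) (k a)).sub S) :=
      fun s => {x | ∀ a, Transversal (π s a) (toSub ((x : S).1 a))}
    refine ⟨{V | V ∈ Set.range U ∧ V.Nonempty}, (Set.finite_range U).subset fun _ h => h.1, ?_, ?_⟩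
    · refine Set.eq_univ_of_forall fun x => ?_
      choose s hs using fun a => exists_transversal_coord (Module.finBasis K (E a)) ((x : S).1 a)
      exact ⟨U s, ⟨⟨s, rfl⟩, x, hs⟩, hs⟩
    · rintro _ ⟨⟨s, rfl⟩, x, -⟩
      exact ⟨isOpen_transversal_pi S (π s), isAffine_transversal_pi hS (π s) x⟩
  · let Q := (Space.pi fun a => grass K (E a) (k a)).sub S
    have h1 : {z : Q.prod Q | z.1 = z.2} =
        ⋂ a, {z : Q.prod Q | toSub ((z.1 : S).1 a) ≤ toSub ((z.2 : S).1 a)} := by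
      ext z
      simp only [Set.mem_iInter, Set.mem_ofPred_eq]
      refine ⟨fun h a => h ▸ le_rfl, fun h => Subtype.ext (funext fun a => toSub_injective ?_)⟩
      exact Submodule.eq_of_le_of_finrank_eq (h a) (by rw [finrank_toSub, finrank_toSub])
    rw [h1]
    exact isClosed_iInter fun a => isClosed_le
      (fun z => (morphAt_apply a _).comp ((morphAt_val _).comp (morphAt_fst z)))
      (fun z => (morphAt_apply a _).comp ((morphAt_val _).comp (morphAt_snd z)))

end PiGrass

/-! ### Transitivity of the linear group on flags, with regular local sections -/

section Flag

theorem exists_linearEquiv_extend {E : Type v'} [AddCommGroup E] [Module K E]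
    [FiniteDimensional K E] {E' : Type w'} [AddCommGroup E'] [Module K E'] [FiniteDimensional K E']
    (hE : Module.finrank K E = Module.finrank K E') {V : Submodule K E} {V' : Submodule K E'}
    (φ : V ≃ₗ[K] V') : ∃ g : E ≃ₗ[K] E', ∀ x : V, g x = φ x := by
  obtain ⟨D, hD⟩ := V.exists_isCompl
  obtain ⟨D', hD'⟩ := V'.exists_isCompl
  have h1 : Module.finrank K D = Module.finrank K D' := by
    have h2 := Submodule.finrank_add_eq_of_isCompl hD
    have h3 := Submodule.finrank_add_eq_of_isCompl hD'
    have h4 := φ.finrank_eq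
    omega
  refine ⟨(V.prodEquivOfIsCompl D hD).symm ≪≫ₗ
    φ.prodCongr (LinearEquiv.ofFinrankEq D D' h1) ≪≫ₗ V'.prodEquivOfIsCompl D' hD', fun x => ?_⟩
  simp

variable {A : Type w} [AddCommGroup A] [Module K A] [FiniteDimensional K A]

/-- The stabilizer of the points of `L` acts transitively on the subspaces of given dimension that
contain `L`. -/
theorem exists_linearEquiv_map_eq {L V V' : Submodule K A} (h : L ≤ V) (h' : L ≤ V')
    (hV : Module.finrank K V = Module.finrank K V') :
    ∃ g : A ≃ₗ[K] A, (∀ x ∈ L, g x = x) ∧ V.map g.toLinearMap = V' := by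
  obtain ⟨φ, hφ⟩ := exists_linearEquiv_extend hV
    (Submodule.comapSubtypeEquivOfLe h ≪≫ₗ (Submodule.comapSubtypeEquivOfLe h').symm)
  obtain ⟨g, hg⟩ := exists_linearEquiv_extend rfl φ
  refine ⟨g, fun x hx => ?_, ?_⟩
  · have h1 := hφ ⟨⟨x, h hx⟩, hx⟩
    have h2 := hg ⟨x, h hx⟩
    simp only at h1 h2
    rw [h2, h1]
    rfl
  · refine Submodule.eq_of_le_of_finrank_eq ?_ ?_
    · rintro _ ⟨x, hx, rfl⟩
      have h2 := hg ⟨x, hx⟩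
      simp only at h2
      rw [LinearEquiv.coe_coe, h2]
      exact Subtype.property _
    · rw [LinearEquiv.finrank_map_eq, hV]

/-- The linear group acts transitively on the flags with given dimensions. -/
theorem exists_linearEquiv_flag {M : ℕ} {β β' : Fin M → Submodule K A} (h : Monotone β)
    (h' : Monotone β') (hd : ∀ q, Module.finrank K (β q) = Module.finrank K (β' q)) :
    ∃ g : A ≃ₗ[K] A, ∀ q, (β q).map g.toLinearMap = β' q := by
  induction M with
  | zero => exact ⟨LinearEquiv.refl K A, fun q => q.elim0⟩
  | succ M ih =>
    obtain ⟨g, hg⟩ := ih (β := fun q => β q.castSucc) (β' := fun q => β' q.castSucc)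
      (h.comp Fin.strictMono_castSucc.monotone) (h'.comp Fin.strictMono_castSucc.monotone)
      fun q => hd _
    obtain ⟨g', hg', hlast⟩ := exists_linearEquiv_map_eq (L := ⨆ q : Fin M, β' q.castSucc)
      (V := (β (Fin.last M)).map g.toLinearMap) (V' := β' (Fin.last M))
      (iSup_le fun q => (hg q).symm.le.trans (Submodule.map_mono (h (Fin.le_last _))))
      (iSup_le fun q => h' (Fin.le_last _)) (by rw [LinearEquiv.finrank_map_eq, hd])
    refine ⟨g ≪≫ₗ g', fun q => ?_⟩
    have h1 : (β q).map (g ≪≫ₗ g').toLinearMap =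
        ((β q).map g.toLinearMap).map g'.toLinearMap := by
      rw [← Submodule.map_comp]
      rfl
    rw [h1]
    induction q using Fin.lastCases with
    | last => exact hlast
    | cast q =>
      rw [hg]
      have h2 : ∀ x ∈ β' q.castSucc, g' x = x :=
        fun x hx => hg' x (Submodule.mem_iSup_of_mem q hx)
      ext x
      refine ⟨?_, fun hx => ⟨x, hx, h2 x hx⟩⟩
      rintro ⟨y, hy, rfl⟩
      rw [LinearEquiv.coe_coe, h2 y hy]
      exact hy

omit [FiniteDimensional K A] in
/-- Endomorphisms that split the identity along a flag: `Q q` has values in the `q`-th space and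
vanishes on the smaller ones, and the sum of all `Q q` is the identity on the flag. -/
theorem exists_flag_splitting {M : ℕ} {S : Fin M → Submodule K A} (h : Monotone S) :
    ∃ Q : Fin M → A →ₗ[K] A, (∀ q x, Q q x ∈ S q) ∧
      (∀ q q', q < q' → ∀ x ∈ S q, Q q' x = 0) ∧ ∀ q, ∀ x ∈ S q, ∑ q', Q q' x = x := by
  induction M with
  | zero => exact ⟨fun _ => 0, fun q => q.elim0, fun q => q.elim0, fun q => q.elim0⟩
  | succ M ih =>
    obtain ⟨Q, hQ1, hQ2, hQ3⟩ := ih (S := fun q => S q.castSucc)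
      (h.comp Fin.strictMono_castSucc.monotone)
    obtain ⟨p, hp⟩ := (S (Fin.last M)).subtype.exists_leftInverse_of_injective
      (S (Fin.last M)).ker_subtype
    have hp' : ∀ x ∈ S (Fin.last M), (p x : A) = x := fun x hx =>
      congr_arg Subtype.val (LinearMap.congr_fun hp ⟨x, hx⟩)
    refine ⟨Fin.snoc (α := fun _ => A →ₗ[K] A) Q
      ((S (Fin.last M)).subtype ∘ₗ p ∘ₗ (LinearMap.id - ∑ q, Q q)), fun q x => ?_,
      fun q q' hq x hx => ?_, fun q x hx => ?_⟩
    · induction q using Fin.lastCases with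
      | last =>
        rw [Fin.snoc_last]
        exact Subtype.property _
      | cast q =>
        rw [Fin.snoc_castSucc]
        exact hQ1 q x
    · induction q using Fin.lastCases with
      | last => exact absurd hq (Fin.le_last _).not_gt
      | cast q =>
        induction q' using Fin.lastCases with
        | last => simp [hQ3 q x hx]
        | cast q' =>
          rw [Fin.snoc_castSucc]
          exact hQ2 q q' (by simpa using hq) x hx
    · rw [Fin.sum_univ_castSucc]
      simp only [Fin.snoc_castSucc, Fin.snoc_last, LinearMap.comp_apply, LinearMap.sub_apply,
        LinearMap.id_apply, LinearMap.sum_apply, Submodule.subtype_apply]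
      rw [hp']
      · abel
      · exact sub_mem (h (Fin.le_last q) hx)
          (sum_mem fun q' _ => h (Fin.le_last _) (hQ1 q' x))

/-- A regular family of endomorphisms that is the identity at `z` is invertible near `z`, with
regular inverse. -/
theorem RegMap.exists_linearEquiv {Z : Space.{u, v} K} {h : Z → A →ₗ[K] A} {z : Z}
    (hh : RegMap Z h z) (hz : h z = LinearMap.id) :
    ∃ g : Z → A ≃ₗ[K] A, RegMap Z (fun y => (g y).toLinearMap) z ∧
      RegMap Z (fun y => (g y).symm.toLinearMap) z ∧ ∀ᶠ y in 𝓝 z, (g y).toLinearMap = h y := by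
  classical
  let b := Module.finBasis K A
  have hM : ∀ i j, (fun y => LinearMap.toMatrix b b (h y) i j) ∈ Z.reg z := fun i j =>
    hh (LinearMap.proj j ∘ₗ LinearMap.proj i ∘ₗ (LinearMap.toMatrix b b).toLinearMap)
  have h0 : (LinearMap.toMatrix b b (h z)).det ≠ 0 := by
    rw [hz, LinearMap.toMatrix_id, Matrix.det_one]
    exact one_ne_zero
  let g : Z → A ≃ₗ[K] A := fun y =>
    if hy : (LinearMap.toMatrix b b (h y)).det ≠ 0 then
      LinearEquiv.ofIsUnitDet (isUnit_iff_ne_zero.2 hy) else LinearEquiv.refl K A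
  have hg : ∀ᶠ y in 𝓝 z, (g y).toLinearMap = h y := by
    filter_upwards [Z.reg_ne_zero (RegMap.det hM) h0] with y hy
    simp only [g]
    rw [dif_pos hy]
    rfl
  refine ⟨g, hh.congr (hg.mono fun y hy => hy.symm), ?_, hg⟩
  have h1 : RegMap Z (fun y => (LinearMap.toMatrix b b (h y))⁻¹) z :=
    regMap_pi.2 fun i => regMap_pi.2 fun j => regMap_iff_mem.2 (RegMap.matrix_inv hM h0 i j)
  refine (h1.linear (Matrix.toLin b b).toLinearMap).congr ?_
  filter_upwards [Z.reg_ne_zero (RegMap.det hM) h0] with y hy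
  simp only [g]
  rw [dif_pos hy]
  rfl

/-- A morphism to a flag variety lifts, near every point, to a morphism to the linear group: a
fixed flag is carried to the moving one by regularly varying automorphisms. -/
theorem exists_local_section {B : Space.{u, v} K} {M : ℕ} {r : Fin M → ℕ}
    {β : ∀ q, B → grass K A (r q)} (b₀ b : B) (hβ : ∀ q, MorphAt B (grass K A (r q)) (β q) b)
    (hmono : ∀ y, Monotone fun q => toSub (β q y)) :
    ∃ g : B → A ≃ₗ[K] A, RegMap B (fun y => (g y).toLinearMap) b ∧
      RegMap B (fun y => (g y).symm.toLinearMap) b ∧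
      ∀ᶠ y in 𝓝 b, ∀ q, (toSub (β q b₀)).map (g y).toLinearMap = toSub (β q y) := by
  obtain ⟨g₀, hg₀⟩ := exists_linearEquiv_flag (hmono b₀) (hmono b)
    fun q => by rw [finrank_toSub, finrank_toSub]
  obtain ⟨Q, hQ1, hQ2, hQ3⟩ := exists_flag_splitting (hmono b)
  choose π hπ using fun q => exists_transversal (β q b)
  -- on the `q`-th space of the flag at `b`, this is `∑ q' ≤ q, p q' ∘ Q q'`, where `p q'` denotes
  -- the projection onto the `q'`-th space of the flag at `y`
  let h : B → A →ₗ[K] A := fun y =>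
    LinearMap.id + ∑ q, (chartProj (π q) (β q y) - LinearMap.id) ∘ₗ Q q
  have hreg : RegMap B h b := by
    refine (regMap_const _ _).add (RegMap.sum fun q _ => ?_)
    exact (((hπ q).regMap_chartProj.comp (hβ q)).sub (regMap_const _ _)).linear
      (LinearMap.lcomp K A (Q q))
  have hb : h b = LinearMap.id := by
    ext x
    have h1 : ∀ q, chartProj (π q) (β q b) (Q q x) = Q q x :=
      fun q => (hπ q).chartProj_eq_iff.2 (hQ1 q x)
    simp [h, h1]
  obtain ⟨g, hg1, hg2, hg3⟩ := hreg.exists_linearEquiv hb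
  refine ⟨fun y => g₀ ≪≫ₗ g y, hg1.linear (LinearMap.lcomp K A g₀.toLinearMap),
    ?_, ?_⟩
  · have h1 := hg2.linear (LinearMap.compRight (M := A) K g₀.symm.toLinearMap)
    exact h1
  filter_upwards [hg3] with y hy q
  have h1 : (toSub (β q b₀)).map (g₀ ≪≫ₗ g y).toLinearMap =
      (toSub (β q b)).map (g y).toLinearMap := by
    rw [← hg₀ q, ← Submodule.map_comp]
    rfl
  rw [h1]
  refine Submodule.eq_of_le_of_finrank_eq ?_ ?_
  · rintro _ ⟨x, hx, rfl⟩
    have h2 : h y x = ∑ q', chartProj (π q') (β q' y) (Q q' x) := by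
      simp only [h, LinearMap.add_apply, LinearMap.sum_apply, LinearMap.comp_apply,
        LinearMap.sub_apply, LinearMap.id_apply, Finset.sum_sub_distrib, hQ3 q x hx]
      abel
    rw [hy, h2]
    refine sum_mem fun q' _ => ?_
    rcases le_or_gt q' q with hq | hq
    · exact hmono y hq (chartProj_mem _ _ _)
    · rw [hQ2 q q' hq x hx, map_zero]
      exact zero_mem _
  · rw [LinearEquiv.finrank_map_eq, finrank_toSub, finrank_toSub]

end Flag

/-! ### Locally trivial bundles and towers of bundles -/

section Bundle

variable {X X' : Space.{u, v} K} {B : Space.{u, w} K} {F : Space.{u, v} K}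

theorem IsLocallyTrivial.isomorphic_of_subsingleton {p : X → B} (h : IsLocallyTrivial X B F p)
    (f : F) (hF : ∀ f' : F, f' = f) : Isomorphic X B := by
  obtain ⟨hp, h⟩ := h
  have hinj : Function.Injective p := by
    intro x x' hx
    obtain ⟨U, hU, hb, e, he, hep⟩ := h (p x)
    have hb' : p x' ∈ U := hx ▸ hb
    have h1 : e (⟨x, hb⟩ : (p ⁻¹' U : Set X)) = e (⟨x', hb'⟩ : (p ⁻¹' U : Set X)) := by
      refine Prod.ext (Subtype.ext ?_) ((hF _).trans (hF _).symm)
      exact (hep ⟨x, hb⟩).trans (hx.trans (hep ⟨x', hb'⟩).symm)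
    exact congr_arg Subtype.val (e.injective h1)
  have hsurj : Function.Surjective p := by
    intro b
    obtain ⟨U, hU, hb, e, he, hep⟩ := h b
    exact ⟨(e.symm ((⟨b, hb⟩ : U), f) : (p ⁻¹' U : Set X)).1, (hep _).symm.trans
      (congr_arg (fun z : U × F => z.1.1) (e.apply_symm_apply ((⟨b, hb⟩ : U), f)))⟩
  let E : X ≃ B := Equiv.ofBijective p ⟨hinj, hsurj⟩
  refine ⟨E, isIso_iff.2 ⟨isMorphism_iff.1 hp, fun b => ?_⟩⟩
  obtain ⟨U, hU, hb, e, he, hep⟩ := h b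
  obtain ⟨ψ, hψ, hψU⟩ := (morphAt_id b).exists_sub (S := U) (hU.mem_nhds hb)
  have h1 : MorphAt B ((B.sub U).prod F) (fun y => (ψ y, f)) b :=
    morphAt_prod hψ (morphAt_const f b)
  have h2 := (morphAt_val _).comp (((isIso_iff.1 he).2 _).comp h1)
  refine h2.congr ?_
  filter_upwards [hU.mem_nhds hb] with y hy
  refine E.injective ((?_ : _ = y).trans (E.apply_symm_apply y).symm)
  refine ((hep _).symm.trans ?_ : p _ = y)
  exact (congr_arg (fun z : U × F => z.1.1) (e.apply_symm_apply (ψ y, f))).trans (hψU y hy)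

theorem IsLocallyTrivial.of_isIso {p : X → B} (h : IsLocallyTrivial X B F p) {E : X' ≃ X}
    (hE : IsIso X' X E) : IsLocallyTrivial X' B F (fun x => p (E x)) := by
  obtain ⟨hp, h⟩ := h
  refine ⟨hp.comp hE.1, fun b => ?_⟩
  obtain ⟨U, hU, hb, e, he, hep⟩ := h b
  rw [isIso_iff] at hE he
  let E' : X'.sub ((fun x => p (E x)) ⁻¹' U) ≃ X.sub (p ⁻¹' U) :=
    E.subtypeEquiv fun x => Iff.rfl
  refine ⟨U, hU, hb, E'.trans e, isIso_iff.2 ⟨fun x => ?_, fun y => ?_⟩, fun x => hep (E' x)⟩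
  · exact (he.1 _).comp (morphAt_sub (φ := E') ((hE.1 _).comp (morphAt_val x)))
  · have h1 : MorphAt (X.sub (p ⁻¹' U)) (X'.sub ((fun x => p (E x)) ⁻¹' U)) E'.symm (e.symm y) :=
      morphAt_sub ((hE.2 _).comp (morphAt_val _))
    exact h1.comp (he.2 y)

theorem IsIteratedBundle.of_isomorphic {L : List (Space.{u, w} K)} (h : IsIteratedBundle X L)
    (hX : Isomorphic X X') : IsIteratedBundle X' L := by
  induction h with
  | iso hX1 hB h => exact .iso (hX1.of_isomorphic hX) hB (hX.symm.trans h)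
  | bundle hX1 hB p hp hF _ =>
    obtain ⟨E, hE⟩ := hX.symm
    exact .bundle (hX1.of_isomorphic hX) hB _ (hp.of_isIso hE) hF

/-- A tower of locally trivial bundles that starts at a point. -/
theorem isIteratedBundle_tower {T : ℕ → Space.{u, v} K} (hT : ∀ t, (T t).IsVariety) (x : T 0)
    (hx : ∀ y : T 0, y = x) (L : List (Space.{u, w} K)) (hL : L ≠ [])
    (hB : ∀ B ∈ L, B.IsVariety)
    (h : ∀ t (ht : t < L.length), ∃ p : T (t + 1) → L[t]'ht,
      IsLocallyTrivial (T (t + 1)) (L[t]'ht) (T t) p) :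
    IsIteratedBundle (T L.length) L := by
  induction L using List.reverseRecOn with
  | nil => exact absurd rfl hL
  | append_singleton L B ih =>
    have h0 := h L.length (by simp)
    rw [List.getElem_concat_length rfl] at h0
    obtain ⟨p, hp⟩ := h0
    rw [List.length_append, List.length_singleton]
    by_cases hL' : L = []
    · subst hL'
      exact .iso (hT _) (hB B (by simp)) (hp.isomorphic_of_subsingleton x hx)
    · refine .bundle (hT _) (hB B (by simp)) p hp (ih hL' (fun B hB' => hB B (by simp [hB'])) ?_)
      intro t ht
      have := h t (by simp; omega)
      rwa [List.getElem_append_left ht] at this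

end Bundle

/-! ### Monotone families of subspaces with some prescribed members -/

section Stage

variable {A : Type w} [AddCommGroup A] [Module K A] {ι : Type} [PartialOrder ι] {k : ι → ℕ}

/-- The monotone families of `k a`-dimensional subspaces of `A`, indexed by the poset `ι`, whose
members outside of `T` are those of the given family `W`. -/
def monoFamilies (W : ∀ a, grass K A (k a)) (T : Set ι) :
    Set (Space.pi fun a => grass K A (k a)) :=
  {V : ∀ a, grass K A (k a) | Monotone (fun a => toSub (V a)) ∧ ∀ s ∉ T, V s = W s}

theorem isClosed_monoFamilies [FiniteDimensional K A] (W : ∀ a, grass K A (k a)) (T : Set ι) :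
    IsClosed (monoFamilies W T) := by
  have h1 : monoFamilies W T =
      (⋂ a, ⋂ a', ⋂ _ : a ≤ a', {V : Space.pi fun a => grass K A (k a) |
        toSub (V a) ≤ toSub (V a')}) ∩
      ⋂ s, ⋂ _ : s ∉ T, {V : Space.pi fun a => grass K A (k a) |
        toSub (V s) ≤ toSub (W s)} := by
    ext V
    simp only [Set.mem_inter_iff, Set.mem_iInter, monoFamilies, Set.mem_ofPred_eq]
    refine and_congr ⟨fun h a a' ha => h ha, fun h a a' ha => h a a' ha⟩
      (forall_congr' fun s => forall_congr' fun _ => ⟨fun h => h ▸ le_rfl, fun h => ?_⟩)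
    exact toSub_injective
      (Submodule.eq_of_le_of_finrank_eq h (by rw [finrank_toSub, finrank_toSub]))
  rw [h1]
  refine IsClosed.inter ?_ ?_
  · exact isClosed_iInter fun a => isClosed_iInter fun a' => isClosed_iInter fun _ =>
      isClosed_le (fun V => morphAt_apply a V) (fun V => morphAt_apply a' V)
  · exact isClosed_iInter fun s => isClosed_iInter fun _ =>
      isClosed_le (fun V => morphAt_apply s V) (fun V => morphAt_const _ V)

/-- An automorphism of `A` acting on the members in `T` of a family of subspaces. -/
def actOn (T : Set ι) (g : A ≃ₗ[K] A) (V : ∀ a, grass K A (k a)) (a : ι) : grass K A (k a) :=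
  open Classical in
  if a ∈ T then ofSub ((toSub (V a)).map g.toLinearMap)
    (by rw [LinearEquiv.finrank_map_eq, finrank_toSub]) else V a

omit [PartialOrder ι] in
theorem toSub_actOn_of_mem {T : Set ι} {a : ι} (ha : a ∈ T) (g : A ≃ₗ[K] A)
    (V : ∀ a, grass K A (k a)) :
    toSub (actOn T g V a) = (toSub (V a)).map g.toLinearMap := by
  rw [actOn, if_pos ha, toSub_ofSub]

omit [PartialOrder ι] in
theorem actOn_of_notMem {T : Set ι} {a : ι} (ha : a ∉ T) (g : A ≃ₗ[K] A)
    (V : ∀ a, grass K A (k a)) : actOn T g V a = V a := by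
  rw [actOn, if_neg ha]

omit [PartialOrder ι] in
theorem actOn_symm_actOn (T : Set ι) (g : A ≃ₗ[K] A) (V : ∀ a, grass K A (k a)) :
    actOn T g.symm (actOn T g V) = V := by
  funext a
  by_cases ha : a ∈ T
  · refine toSub_injective ?_
    rw [toSub_actOn_of_mem ha, toSub_actOn_of_mem ha, ← Submodule.map_comp]
    simp
  · rw [actOn_of_notMem ha, actOn_of_notMem ha]

omit [PartialOrder ι] in
theorem MorphAt.actOn [FiniteDimensional K A] {Z : Space.{u, v'} K} {z : Z} (T : Set ι)
    {g : Z → A ≃ₗ[K] A} (hg : RegMap Z (fun y => (g y).toLinearMap) z)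
    {φ : Z → Space.pi fun a => grass K A (k a)}
    (hφ : MorphAt Z (Space.pi fun a => grass K A (k a)) φ z) :
    MorphAt Z (Space.pi fun a => grass K A (k a)) (fun y => actOn T (g y) (φ y)) z := by
  refine morphAt_pi fun a => ?_
  have h1 := (morphAt_apply a (φ z)).comp hφ
  by_cases ha : a ∈ T
  · exact h1.map_sup hg ⊥ (Eventually.of_forall fun y =>
      (toSub_actOn_of_mem ha _ _).trans (sup_bot_eq _).symm)
  · exact h1.congr (Eventually.of_forall fun y => (actOn_of_notMem ha _ _).symm)

section

variable {W : ∀ a, grass K A (k a)} {T : Set ι} {M : ℕ} {c : Fin M → ι} {B : Type*}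
  {β : ∀ q, B → grass K A (k (c q))}

/-- An automorphism that carries the flag `β b` to `β b'` acts on the families whose members at the
positions `c` form the flag `β b`. -/
theorem actOn_mem_monoFamilies
    (hup : ∀ b q, ∀ s ∉ T, c q ≤ s → toSub (β q b) ≤ toSub (W s))
    (hdown : ∀ b q, ∀ s ∉ T, s ≤ c q → toSub (W s) ≤ toSub (β q b))
    (hT : ∀ a ∈ T, ∀ s ∉ T, a ≤ s → ∃ q, a ≤ c q ∧ c q ≤ s)
    (hT' : ∀ s ∉ T, ∀ a ∈ T, s ≤ a → ∃ q, s ≤ c q ∧ c q ≤ a)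
    {V : ∀ a, grass K A (k a)} (hV : V ∈ monoFamilies W T) {b b' : B}
    (hb : ∀ q, V (c q) = β q b) {g : A ≃ₗ[K] A}
    (hg : ∀ q, (toSub (β q b)).map g.toLinearMap = toSub (β q b')) :
    actOn T g V ∈ monoFamilies W T ∧ ∀ q, actOn T g V (c q) = β q b' := by
  obtain ⟨hmono, hfix⟩ := hV
  refine ⟨⟨fun a a' haa => ?_, fun s hs => (actOn_of_notMem hs g V).trans (hfix s hs)⟩,
    fun q => ?_⟩
  · change toSub (actOn T g V a) ≤ toSub (actOn T g V a')
    by_cases ha : a ∈ T <;> by_cases ha' : a' ∈ T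
    · rw [toSub_actOn_of_mem ha, toSub_actOn_of_mem ha']
      exact Submodule.map_mono (hmono haa)
    · obtain ⟨q, h1, h2⟩ := hT a ha a' ha' haa
      rw [toSub_actOn_of_mem ha, actOn_of_notMem ha', hfix a' ha']
      refine (Submodule.map_mono (hmono h1)).trans ?_
      change (toSub (V (c q))).map _ ≤ _
      rw [hb, hg]
      exact hup b' q a' ha' h2
    · obtain ⟨q, h1, h2⟩ := hT' a ha a' ha' haa
      rw [toSub_actOn_of_mem ha', actOn_of_notMem ha, hfix a ha]
      refine le_trans ?_ (Submodule.map_mono (hmono h2))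
      change _ ≤ (toSub (V (c q))).map _
      rw [hb, hg]
      exact hdown b' q a ha h1
    · rw [actOn_of_notMem ha, actOn_of_notMem ha']
      exact hmono haa
  · refine toSub_injective ?_
    by_cases hq : c q ∈ T
    · rw [toSub_actOn_of_mem hq, hb, hg]
    · rw [actOn_of_notMem hq, hfix _ hq]
      exact le_antisymm (hdown b' q _ hq le_rfl) (hup b' q _ hq le_rfl)

end

set_option maxHeartbeats 600000 in
/-- The projection of a variety of monotone families to the members at the positions `c` is a
locally trivial bundle, if these members form a flag that separates the members in `T` from the
prescribed ones: every relation between the two kinds passes through a position `c q`. The base `B`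
parametrizes these flags by `β`. -/
theorem isLocallyTrivial_monoFamilies [FiniteDimensional K A] {W : ∀ a, grass K A (k a)}
    (hW : Monotone fun a => toSub (W a)) {T : Set ι} {M : ℕ} {c : Fin M → ι}
    {B : Space.{u, v'} K} {β : ∀ q, B → grass K A (k (c q))}
    (hβ : ∀ q b, MorphAt B (grass K A (k (c q))) (β q) b)
    (hmono : ∀ b, Monotone fun q => toSub (β q b))
    (hinj : ∀ b b', (∀ q, β q b = β q b') → b = b')
    (hup : ∀ b q, ∀ s ∉ T, c q ≤ s → toSub (β q b) ≤ toSub (W s))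
    (hdown : ∀ b q, ∀ s ∉ T, s ≤ c q → toSub (W s) ≤ toSub (β q b))
    (hT : ∀ a ∈ T, ∀ s ∉ T, a ≤ s → ∃ q, a ≤ c q ∧ c q ≤ s)
    (hT' : ∀ s ∉ T, ∀ a ∈ T, s ≤ a → ∃ q, s ≤ c q ∧ c q ≤ a)
    {p : (Space.pi fun a => grass K A (k a)).sub (monoFamilies W T) → B}
    (hp : IsMorphism ((Space.pi fun a => grass K A (k a)).sub (monoFamilies W T)) B p)
    (hpβ : ∀ (V : monoFamilies W T) q, β q (p V) = V.1 (c q)) :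
    IsLocallyTrivial ((Space.pi fun a => grass K A (k a)).sub (monoFamilies W T)) B
      ((Space.pi fun a => grass K A (k a)).sub (monoFamilies W (T \ Set.range c))) p := by
  let P := Space.pi fun a => grass K A (k a)
  refine ⟨hp, fun b => ?_⟩
  let b₀ : B := p (⟨W, hW, fun _ _ => rfl⟩ : monoFamilies W T)
  have hb₀ : ∀ q, β q b₀ = W (c q) := hpβ _
  -- the fibre over `b₀`
  have hfib : ∀ V : P, V ∈ monoFamilies W (T \ Set.range c) ↔
      V ∈ monoFamilies W T ∧ ∀ q, V (c q) = β q b₀ := by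
    intro V
    constructor
    · rintro ⟨h1, h2⟩
      exact ⟨⟨h1, fun s hs => h2 s fun h => hs h.1⟩,
        fun q => (h2 _ fun h => h.2 ⟨q, rfl⟩).trans (hb₀ q).symm⟩
    · rintro ⟨⟨h1, h2⟩, h3⟩
      refine ⟨h1, fun s hs => ?_⟩
      by_cases hsT : s ∈ T
      · obtain ⟨q, rfl⟩ : s ∈ Set.range c := by
          by_contra h
          exact hs ⟨hsT, h⟩
        exact (h3 q).trans (hb₀ q)
      · exact h2 s hsT
  obtain ⟨g, hg, hg', hgβ⟩ := exists_local_section b₀ b (fun q => hβ q b) hmono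
  obtain ⟨U, hU, hUo, hbU⟩ := eventually_nhds_iff.1 (hg.eventually.and (hg'.eventually.and hgβ))
  have hto : ∀ u ∈ U, ∀ V : P, V ∈ monoFamilies W (T \ Set.range c) →
      actOn T (g u) V ∈ monoFamilies W T ∧ ∀ q, actOn T (g u) V (c q) = β q u :=
    fun u hu V hV => actOn_mem_monoFamilies hup hdown hT hT' ((hfib V).1 hV).1 ((hfib V).1 hV).2
      (hU u hu).2.2
  have hfrom : ∀ V : monoFamilies W T, p V ∈ U →
      actOn T (g (p V)).symm V.1 ∈ monoFamilies W (T \ Set.range c) := by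
    intro V hV
    refine (hfib _).2 (actOn_mem_monoFamilies hup hdown hT hT' V.2 (fun q => (hpβ V q).symm)
      fun q => ?_)
    rw [← (hU _ hV).2.2 q, ← Submodule.map_comp]
    simp
  have hpto : ∀ u (hu : u ∈ U) V hV, p (⟨actOn T (g u) V, (hto u hu V hV).1⟩ : monoFamilies W T)
      = u := fun u hu V hV => hinj _ _ fun q => (hpβ _ q).trans ((hto u hu V hV).2 q)
  let F := P.sub (monoFamilies W (T \ Set.range c))
  let e : (P.sub (monoFamilies W T)).sub (p ⁻¹' U) ≃ (B.sub U).prod F :=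
    { toFun := fun x => ((⟨p (x : (p ⁻¹' U : Set _)).1, (x : (p ⁻¹' U : Set _)).2⟩ : U),
        (⟨_, hfrom (x : (p ⁻¹' U : Set _)).1 (x : (p ⁻¹' U : Set _)).2⟩ : monoFamilies W _))
      invFun := fun y => (⟨(⟨_, (hto (y.1 : U).1 (y.1 : U).2 _ (y.2 : monoFamilies W _).2).1⟩ :
        monoFamilies W T), show p _ ∈ U from Set.mem_of_eq_of_mem
          (hpto _ (y.1 : U).2 _ (y.2 : monoFamilies W _).2) (y.1 : U).2⟩ : (p ⁻¹' U : Set _))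
      left_inv := fun x => Subtype.ext (Subtype.ext
        (actOn_symm_actOn T (g (p (x : (p ⁻¹' U : Set _)).1)).symm _))
      right_inv := fun y => by
        have h1 := hpto _ (y.1 : U).2 _ (y.2 : monoFamilies W _).2
        refine Prod.ext (Subtype.ext h1) (Subtype.ext ?_)
        refine Eq.trans ?_ (actOn_symm_actOn T (g (y.1 : U).1) _)
        exact congr_arg (fun u => actOn T (g u).symm _) h1 }
  refine ⟨U, hUo, hbU, e, isIso_iff.2 ⟨fun x => ?_, fun y => ?_⟩, fun x => rfl⟩
  · have h1 := (isMorphism_iff.1 hp _).comp (morphAt_val x)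
    refine morphAt_prod (morphAt_sub h1) (morphAt_sub ?_)
    have h2 : RegMap B (fun u => (g u).symm.toLinearMap) (p (x : (p ⁻¹' U : Set _)).1) :=
      (hU _ (x : (p ⁻¹' U : Set _)).2).2.1
    have h3 : RegMap ((P.sub (monoFamilies W T)).sub (p ⁻¹' U))
        (fun x => (g (p (x : (p ⁻¹' U : Set _)).1)).symm.toLinearMap) x := fun l => h1.2 _ (h2 l)
    exact MorphAt.actOn T (g := fun x => (g (p (x : (p ⁻¹' U : Set _)).1)).symm) h3
      ((morphAt_val _).comp (morphAt_val x))
  · have h1 := (morphAt_val _).comp (morphAt_fst y)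
    refine morphAt_sub (morphAt_sub ?_)
    have h2 : RegMap B (fun u => (g u).toLinearMap) (y.1 : U).1 := (hU _ (y.1 : U).2).1
    exact MorphAt.actOn T (g := fun y : (B.sub U).prod F => g (y.1 : U).1)
      (RegMap.comp (φ := fun y : (B.sub U).prod F => (y.1 : U).1) h2 h1)
      ((morphAt_val _).comp (morphAt_snd y))

end Stage

/-! ### Linear algebra of standard flags and intervals of subspaces -/

section LinearAlgebra

theorem finrank_map_of_injective {E : Type v'} [AddCommGroup E] [Module K E] {E' : Type w'}
    [AddCommGroup E'] [Module K E'] {f : E →ₗ[K] E'} (hf : Function.Injective f)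
    (S : Submodule K E) : Module.finrank K (S.map f) = Module.finrank K S :=
  (Submodule.equivMapOfInjective f hf S).finrank_eq.symm

theorem finrank_stdFlag {m : ℕ} {e : Fin (m + 1) → ℕ} {i : Fin (m + 1)} (h : e i ≤ e (Fin.last m)) :
    Module.finrank K (stdFlag K e i) = e i := by
  let φ : stdFlag K e i ≃ₗ[K] (Fin (e i) → K) :=
    { toFun := fun x l => x.1 (Fin.castLE h l)
      map_add' := fun _ _ => rfl
      map_smul' := fun _ _ => rfl
      invFun := fun y => ⟨fun l => if hl : l.val < e i then y ⟨l.val, hl⟩ else 0,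
        fun l hl => dif_neg (not_lt.2 hl)⟩
      left_inv := fun x => by
        ext l
        by_cases hl : l.val < e i
        · simp [hl]
        · simp [hl, x.2 l (not_lt.1 hl)]
      right_inv := fun y => by
        ext l
        simp }
  rw [φ.finrank_eq, Module.finrank_fintype_fun_eq_card, Fintype.card_fin]

theorem stdFlag_mono {m : ℕ} {e : Fin (m + 1) → ℕ} (he : Monotone e) : Monotone (stdFlag K e) :=
  fun _ _ h _ hx l hl => hx l ((he h).trans hl)

variable {A : Type w} [AddCommGroup A] [Module K A] [FiniteDimensional K A]

/-- The standard flag embeds onto any flag with the same dimensions. -/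
theorem exists_stdFlag_embedding {m : ℕ} {e : Fin (m + 1) → ℕ} (he : Monotone e)
    {S : Fin (m + 1) → Submodule K A} (hS : Monotone S) (hd : ∀ i, Module.finrank K (S i) = e i) :
    ∃ f : stdFlag K e (Fin.last m) →ₗ[K] A, Function.Injective f ∧
      ∀ i, ((stdFlag K e i).comap (stdFlag K e (Fin.last m)).subtype).map f = S i := by
  have h1 : Module.finrank K (stdFlag K e (Fin.last m)) = Module.finrank K (S (Fin.last m)) := by
    rw [finrank_stdFlag le_rfl, hd]
  let f₀ : stdFlag K e (Fin.last m) →ₗ[K] A :=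
    (S (Fin.last m)).subtype ∘ₗ (LinearEquiv.ofFinrankEq _ _ h1).toLinearMap
  have hf₀ : Function.Injective f₀ :=
    Subtype.val_injective.comp (LinearEquiv.ofFinrankEq _ _ h1).injective
  obtain ⟨g, hg⟩ := exists_linearEquiv_flag
    (β := fun i => ((stdFlag K e i).comap (stdFlag K e (Fin.last m)).subtype).map f₀)
    (fun _ _ h => Submodule.map_mono (Submodule.comap_mono (stdFlag_mono he h))) hS fun i => by
      rw [finrank_map_of_injective hf₀, hd]
      exact (Submodule.comapSubtypeEquivOfLe (stdFlag_mono he (Fin.le_last i))).finrank_eq.trans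
        (finrank_stdFlag (he (Fin.le_last i)))
  refine ⟨g.toLinearMap ∘ₗ f₀, g.injective.comp hf₀, fun i => ?_⟩
  rw [Submodule.map_comp]
  exact hg i

/-- A flag of `A` is part of a complete flag. -/
theorem exists_complete_flag {m : ℕ} {S : Fin (m + 1) → Submodule K A} (hS : Monotone S) :
    ∃ E : ℕ → Submodule K A, Monotone E ∧
      (∀ k ≤ Module.finrank K A, Module.finrank K (E k) = k) ∧
      ∀ i, E (Module.finrank K (S i)) = S i := by
  let b := Module.finBasis K A
  let E₀ : ℕ → Submodule K A := fun k => Submodule.span K (b '' {i | i.val < k})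
  have hE₀ : Monotone E₀ := fun k k' h =>
    Submodule.span_mono (Set.image_mono fun i (hi : i.val < k) => lt_of_lt_of_le hi h)
  have hdim : ∀ k ≤ Module.finrank K A, Module.finrank K (E₀ k) = k := by
    intro k hk
    have h1 : E₀ k = Submodule.span K (Set.range (b ∘ Fin.castLE hk)) := by
      rw [Set.range_comp]
      refine congr_arg (fun s => Submodule.span K (b '' s)) (Set.ext fun i => ?_)
      exact ⟨fun hi => ⟨⟨i.val, hi⟩, rfl⟩, fun ⟨l, hl⟩ => hl ▸ l.2⟩
    rw [h1, finrank_span_eq_card (b.linearIndependent.comp _ (Fin.castLE_injective hk)),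
      Fintype.card_fin]
  have hle : ∀ i, Module.finrank K (S i) ≤ Module.finrank K A := fun i => Submodule.finrank_le _
  obtain ⟨g, hg⟩ := exists_linearEquiv_flag (β := fun i => E₀ (Module.finrank K (S i)))
    (fun _ _ h => hE₀ (Submodule.finrank_mono (hS h))) hS fun i => hdim _ (hle i)
  exact ⟨fun k => (E₀ k).map g.toLinearMap, fun _ _ h => Submodule.map_mono (hE₀ h),
    fun k hk => by rw [LinearEquiv.finrank_map_eq, hdim k hk], hg⟩

/-- The quotient `U / L` is identified with `K^N` by an injection `f` onto a complement of `L` in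
`U` and a retraction `r` that vanishes on `L`. -/
theorem exists_interval_splitting {L U : Submodule K A} (h : L ≤ U) {N : ℕ}
    (hN : Module.finrank K L + N = Module.finrank K U) :
    ∃ (f : (Fin N → K) →ₗ[K] A) (r : A →ₗ[K] Fin N → K), (∀ x, r (f x) = x) ∧
      (∀ x ∈ L, r x = 0) ∧ (∀ x, f x ∈ U) ∧ ∀ x ∈ U, x - f (r x) ∈ L := by
  obtain ⟨D, hD⟩ := L.exists_isCompl
  have hsup : L ⊔ D ⊓ U = U := by
    rw [sup_inf_assoc_of_le D h |>.symm, hD.sup_eq_top, top_inf_eq]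
  have hinf : L ⊓ (D ⊓ U) = ⊥ := by
    rw [← inf_assoc, hD.inf_eq_bot, bot_inf_eq]
  have hdim : Module.finrank K (Fin N → K) = Module.finrank K (D ⊓ U : Submodule K A) := by
    have h1 := Submodule.finrank_sup_add_finrank_inf_eq L (D ⊓ U)
    rw [hsup, hinf, finrank_bot] at h1
    rw [Module.finrank_fintype_fun_eq_card, Fintype.card_fin]
    omega
  let f : (Fin N → K) →ₗ[K] A :=
    (D ⊓ U).subtype ∘ₗ (LinearEquiv.ofFinrankEq _ _ hdim).toLinearMap
  have hfi : Function.Injective f :=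
    Subtype.val_injective.comp (LinearEquiv.ofFinrankEq _ _ hdim).injective
  have hfm : ∀ x, f x ∈ D ⊓ U := fun x => Subtype.property _
  have hker : LinearMap.ker (L.subtype.coprod f) = ⊥ := by
    refine LinearMap.ker_eq_bot'.2 fun ⟨l, x⟩ hx => ?_
    simp only [LinearMap.coprod_apply, Submodule.subtype_apply] at hx
    have h1 : f x ∈ L ⊓ (D ⊓ U) :=
      ⟨by rw [eq_neg_of_add_eq_zero_right hx]; exact neg_mem l.2, hfm x⟩
    rw [hinf, Submodule.mem_bot] at h1
    rw [h1, add_zero] at hx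
    exact Prod.ext (Subtype.ext hx) (hfi (h1.trans (map_zero f).symm))
  obtain ⟨s, hs⟩ := (L.subtype.coprod f).exists_leftInverse_of_injective hker
  have hs' : ∀ l (x : Fin N → K), s ((l : L) + f x) = (l, x) := fun l x => by
    have := LinearMap.congr_fun hs (l, x)
    simpa using this
  refine ⟨f, LinearMap.snd K L (Fin N → K) ∘ₗ s, fun x => ?_, fun x hx => ?_,
    fun x => (hfm x).2, fun x hx => ?_⟩
  · have := hs' 0 x
    rw [Submodule.coe_zero, zero_add] at this
    simp [this]
  · have := hs' ⟨x, hx⟩ 0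
    rw [map_zero, add_zero] at this
    simp [this]
  · rw [← hsup] at hx
    obtain ⟨l, hl, y, hy, rfl⟩ := Submodule.mem_sup.1 hx
    obtain ⟨z, hz⟩ := (LinearEquiv.ofFinrankEq _ _ hdim).surjective ⟨y, hy⟩
    have hz' : f z = y := congr_arg Subtype.val hz
    have := hs' ⟨l, hl⟩ z
    rw [hz'] at this
    simp [this, hz', hl]

end LinearAlgebra

/-! ### Schubert varieties -/

section Schubert

variable {A : Type w} [AddCommGroup A] [Module K A] [FiniteDimensional K A] {m : ℕ}

theorem isVariety_grass (k : ℕ) : (grass K A k).IsVariety := by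
  let P := Space.pi fun _ : Unit => grass K A k
  have h1 : (P.sub Set.univ).IsVariety := isVariety_pi_grass isClosed_univ
  let e : P.sub Set.univ ≃ grass K A k :=
    { toFun := fun V => (V : (Set.univ : Set P)).1 ()
      invFun := fun V => (⟨fun _ => V, trivial⟩ : (Set.univ : Set P))
      left_inv := fun _ => rfl
      right_inv := fun _ => rfl }
  refine h1.of_isomorphic ⟨e, isIso_iff.2 ⟨fun V => ?_, fun V => ?_⟩⟩
  · exact (morphAt_apply () _).comp (morphAt_val V)
  · exact morphAt_sub (morphAt_pi fun _ => morphAt_id V)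

theorem isVariety_schubert (As : Fin (m + 1) → Submodule K A) (k : Fin (m + 1) → ℕ) :
    (schubert As k).IsVariety := by
  let E := As (Fin.last m)
  let P := Space.pi fun i : Fin (m + 1) => grass K E (k i)
  let S : Set P := {V | (∀ i i', i ≤ i' → toSub (V i) ≤ toSub (V i')) ∧
    ∀ i, (toSub (V i)).map E.subtype ≤ As i}
  have hS : IsClosed S := by
    have h1 : S = (⋂ i, ⋂ i', ⋂ _ : i ≤ i', {V : P | toSub (V i) ≤ toSub (V i')}) ∩
        ⋂ i, {V : P | toSub (V i) ≤
          toSub (ofSub ((As i).comap E.subtype) rfl : grass K E _)} := by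
      ext V
      simp only [Set.mem_inter_iff, Set.mem_iInter, S, Set.mem_ofPred_eq, toSub_ofSub,
        Submodule.map_le_iff_le_comap]
    rw [h1]
    refine IsClosed.inter ?_ ?_
    · exact isClosed_iInter fun a => isClosed_iInter fun a' => isClosed_iInter fun _ =>
        isClosed_le (fun V => morphAt_apply a V) (fun V => morphAt_apply a' V)
    · exact isClosed_iInter fun i => isClosed_le (fun V => morphAt_apply i V)
        (fun V => morphAt_const _ V)
  let e : P.sub S ≃ schubert As k :=
    { toFun := fun V => ⟨⟨(V : S).1, (V : S).2.1⟩, (V : S).2.2⟩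
      invFun := fun V => (⟨V.1.1, V.1.2, V.2⟩ : S)
      left_inv := fun _ => rfl
      right_inv := fun _ => rfl }
  refine (isVariety_pi_grass hS).of_isomorphic ⟨e, isIso_iff.2 ⟨fun V => ?_, fun V => ?_⟩⟩
  · exact morphAt_sub (morphAt_sub (morphAt_val V))
  · have h1 : MorphAt (schubert As k) P (fun V => V.1.1) V :=
      (morphAt_val (X := P) V.1).comp (morphAt_val V)
    exact morphAt_sub h1

end Schubert

/-! ### The grid of subspaces, completed by the column of the ambient flag -/

section Grid

variable {m n : ℕ}

/-- The matrix `κ` completed by a last column `d`. -/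
def gridDim (κ : Fin (m + 1) → Fin (n + 1) → ℕ) (d : Fin (m + 1) → ℕ)
    (a : Fin (m + 1) × Fin (n + 2)) : ℕ :=
  Fin.lastCases (motive := fun _ => ℕ) (d a.1) (κ a.1) a.2

variable {κ : Fin (m + 1) → Fin (n + 1) → ℕ} {d : Fin (m + 1) → ℕ}

@[simp] theorem gridDim_castSucc (i : Fin (m + 1)) (j : Fin (n + 1)) :
    gridDim κ d (i, j.castSucc) = κ i j := by
  simp [gridDim]

@[simp] theorem gridDim_last (i : Fin (m + 1)) : gridDim κ d (i, Fin.last (n + 1)) = d i := by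
  simp [gridDim]

theorem gridDim_succ (i : Fin (m + 1)) (j : Fin (n + 1)) :
    gridDim κ d (i, j.succ) = nextCol κ d j i := by
  unfold nextCol
  split_ifs with h
  · have : j.succ = Fin.castSucc ⟨j.val + 1, h⟩ := rfl
    rw [this, gridDim_castSucc]
  · have : j.succ = Fin.last (n + 1) := by
      ext
      simp
      omega
    rw [this, gridDim_last]

theorem gridDim_mono (hd : Monotone d) (hκd : ∀ i j, κ i j ≤ d i)
    (hκ : ∀ i i' j j', i ≤ i' → j ≤ j' → κ i j ≤ κ i' j') : Monotone (gridDim κ d) := by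
  rintro ⟨i, j⟩ ⟨i', j'⟩ ⟨hi, hj⟩
  simp only at hi hj
  induction j' using Fin.lastCases with
  | last =>
    rw [gridDim_last]
    induction j using Fin.lastCases with
    | last => simpa using hd hi
    | cast j => simpa using (hκd i j).trans (hd hi)
  | cast j' =>
    induction j using Fin.lastCases with
    | last => exact absurd hj (Fin.castSucc_lt_last j').not_ge
    | cast j => simpa using hκ i i' j j' hi (by simpa using hj)

end Grid

section Stages

variable {m n : ℕ} {κ : Fin (m + 1) → Fin (n + 1) → ℕ} {d : Fin (m + 1) → ℕ}
  {A : Type w} [AddCommGroup A] [Module K A] [FiniteDimensional K A]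
  {W : ∀ a, grass K A (gridDim κ d a)}

/-- The projection to a whole column, when the later columns are prescribed. -/
theorem exists_isLocallyTrivial_column (hW : Monotone fun a => toSub (W a)) (j : Fin (n + 1)) :
    ∃ p, IsLocallyTrivial ((Space.pi fun a => grass K A (gridDim κ d a)).sub
        (monoFamilies W {a | a.2.val < j.val + 1}))
      (schubertN K (fun i => κ i j) (nextCol κ d j))
      ((Space.pi fun a => grass K A (gridDim κ d a)).sub
        (monoFamilies W {a | a.2.val < j.val})) p := by
  have hdimW : ∀ i, Module.finrank K (toSub (W (i, j.succ))) = nextCol κ d j i := fun i => by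
    rw [finrank_toSub, gridDim_succ]
  have hWcol : Monotone fun i => toSub (W (i, j.succ)) := fun i i' h => hW ⟨h, le_rfl⟩
  have hcol : Monotone (nextCol κ d j) := fun i i' h => by
    rw [← hdimW, ← hdimW]
    exact Submodule.finrank_mono (hWcol h)
  obtain ⟨f, hf, hfW⟩ := exists_stdFlag_embedding hcol hWcol hdimW
  obtain ⟨r, hr⟩ := f.exists_leftInverse_of_injective (LinearMap.ker_eq_bot.2 hf)
  have hr' : ∀ x, r (f x) = x := fun x => LinearMap.congr_fun hr x
  set T : Set (Fin (m + 1) × Fin (n + 2)) := {a | a.2.val < j.val + 1} with hTdef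
  let X := (Space.pi fun a => grass K A (gridDim κ d a)).sub (monoFamilies W T)
  -- the members of the column are contained in the image of `f`
  have hVle : ∀ V ∈ monoFamilies W T, ∀ i, toSub (V (i, j.castSucc)) ≤ toSub (W (i, j.succ)) := by
    intro V hV i
    rw [← hV.2 (i, j.succ) (by simp [T])]
    exact hV.1 ⟨le_rfl, Fin.castSucc_le_succ j⟩
  have hfr : ∀ V ∈ monoFamilies W T, ∀ i,
      ((toSub (V (i, j.castSucc))).map r).map f = toSub (V (i, j.castSucc)) := by
    intro V hV i
    have h1 : ∀ x ∈ toSub (V (i, j.castSucc)), f (r x) = x := by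
      intro x hx
      have h2 := hVle V hV i hx
      rw [← hfW] at h2
      obtain ⟨y, -, rfl⟩ := h2
      rw [hr']
    ext x
    constructor
    · rintro ⟨_, ⟨y, hy, rfl⟩, rfl⟩
      rw [h1 y hy]
      exact hy
    · intro hx
      exact ⟨r x, ⟨x, hx, rfl⟩, h1 x hx⟩
  let p : X → schubertN K (fun i => κ i j) (nextCol κ d j) := fun V =>
    ⟨⟨fun i => ⟨(toSub ((V : monoFamilies W T).1 (i, j.castSucc))).map r, by
        rw [← finrank_map_of_injective hf, hfr _ (V : monoFamilies W T).2, finrank_toSub,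
          gridDim_castSucc]⟩,
      fun i i' h => Submodule.map_mono ((V : monoFamilies W T).2.1 ⟨h, le_rfl⟩)⟩, fun i => by
        rw [Submodule.map_le_iff_le_comap, Submodule.map_le_iff_le_comap]
        intro x hx
        have h2 := hVle _ (V : monoFamilies W T).2 i hx
        rw [← hfW] at h2
        obtain ⟨y, hy, rfl⟩ := h2
        rw [Submodule.mem_comap, hr']
        exact hy⟩
  let β : ∀ q : Fin (m + 1), schubertN K (fun i => κ i j) (nextCol κ d j) →
      grass K A (gridDim κ d (q, j.castSucc)) := fun q b =>
    ofSub ((b.1.1 q).1.map f) (by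
      rw [finrank_map_of_injective hf, gridDim_castSucc]
      exact (b.1.1 q).2)
  have hβle : ∀ q b, toSub (β q b) ≤ toSub (W (q, j.succ)) := by
    intro q b
    rw [← hfW]
    exact Submodule.map_mono (Submodule.map_le_iff_le_comap.1 (b.2 q))
  refine ⟨p, ?_⟩
  have key := isLocallyTrivial_monoFamilies hW (T := T) (c := fun q => (q, j.castSucc)) (β := β)
    (p := p) (fun q b => ?_) (fun b q q' h => ?_) (fun b b' h => ?_) (fun b q s hs hqs => ?_)
    (fun b q s hs hqs => ?_) (fun a ha s hs has => ?_) (fun s hs a ha has => ?_) ?_ (fun V q => ?_)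
  · convert key using 4
    ext a
    simp only [T, Set.mem_sdiff, Set.mem_ofPred_eq, Set.mem_range, Prod.ext_iff,
      not_exists, not_and, Fin.ext_iff, Fin.val_castSucc]
    constructor
    · exact fun h => ⟨by omega, fun x hx => by omega⟩
    · exact fun ⟨h1, h2⟩ => by have := h2 a.1 rfl; omega
  · have h1 : MorphAt (schubertN K (fun i => κ i j) (nextCol κ d j))
        (grass K (stdFlag K (nextCol κ d j) (Fin.last m)) (κ q j)) (fun b => b.1.1 q) b :=
      (morphAt_apply q _).comp ((morphAt_val b.1).comp (morphAt_val b))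
    exact h1.map f (Eventually.of_forall fun _ => rfl)
  · exact Submodule.map_mono (b.1.2 q q' h)
  · refine Subtype.ext (Subtype.ext (funext fun q => Subtype.ext ?_))
    exact Submodule.map_injective_of_injective hf (congr_arg toSub (h q))
  · refine (hβle q b).trans (hW ⟨hqs.1, ?_⟩)
    simp only [T, Set.mem_ofPred_eq, not_lt] at hs
    exact hs
  · have h1 := hqs.2
    simp only [T, Set.mem_ofPred_eq, not_lt] at hs
    simp only [Fin.le_def, Fin.val_castSucc] at h1
    omega
  · simp only [T, Set.mem_ofPred_eq, not_lt] at ha hs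
    refine ⟨a.1, ⟨le_rfl, ?_⟩, ⟨has.1, ?_⟩⟩ <;> simp only [Fin.le_def, Fin.val_castSucc] <;> omega
  · have h1 := has.2
    simp only [T, Set.mem_ofPred_eq, not_lt] at ha hs
    simp only [Fin.le_def] at h1
    omega
  · refine isMorphism_iff.2 fun V => morphAt_sub (morphAt_sub (morphAt_pi fun i => ?_))
    have h1 := (morphAt_apply (i, j.castSucc) _).comp (morphAt_val V)
    exact h1.map r (Eventually.of_forall fun _ => rfl)
  · exact toSub_injective (hfr V.1 V.2 q)

/-- The projection to a single member `V i j`, when the later columns and the members of the same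
column above it are prescribed. -/
theorem exists_isLocallyTrivial_entry (hW : Monotone fun a => toSub (W a)) (i : Fin (m + 1))
    (j : Fin (n + 1)) :
    ∃ p, IsLocallyTrivial ((Space.pi fun a => grass K A (gridDim κ d a)).sub
        (monoFamilies W {a | a.2.val < j.val ∨ a.2.val = j.val ∧ i ≤ a.1}))
      (grassN K (delta κ i j) (delta κ i j + epsilon κ d i j))
      ((Space.pi fun a => grass K A (gridDim κ d a)).sub
        (monoFamilies W {a | a.2.val < j.val ∨ a.2.val = j.val ∧ i < a.1})) p := by
  set T : Set (Fin (m + 1) × Fin (n + 2)) :=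
    {a | a.2.val < j.val ∨ a.2.val = j.val ∧ i ≤ a.1} with hTdef
  have memT : ∀ a, a ∈ T ↔ a.2.val < j.val ∨ a.2.val = j.val ∧ i ≤ a.1 := fun _ => Iff.rfl
  let X := (Space.pi fun a => grass K A (gridDim κ d a)).sub (monoFamilies W T)
  let U : Submodule K A := toSub (W (i, j.succ))
  -- the largest prescribed member below the position `(i, j)`
  obtain ⟨L, hLdim, hLW, hWL⟩ : ∃ L : Submodule K A, Module.finrank K L + delta κ i j = κ i j ∧
      (∀ V ∈ monoFamilies W T, L ≤ toSub (V (i, j.castSucc))) ∧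
      ∀ s ∉ T, s ≤ (i, j.castSucc) → toSub (W s) ≤ L := by
    induction i using Fin.cases with
    | zero =>
      refine ⟨⊥, by simp [delta], fun _ _ => bot_le, fun s hs hsi => absurd hs (not_not.2 ?_)⟩
      have h2 := hsi.2
      simp only [Fin.le_def, Fin.val_castSucc] at h2
      simp [memT]
      omega
    | succ i =>
      have hle : (i.castSucc, j.castSucc) ≤ (i.succ, j.castSucc) :=
        ⟨Fin.castSucc_le_succ i, le_rfl⟩
      refine ⟨toSub (W (i.castSucc, j.castSucc)), ?_, fun V hV => ?_, fun s hs hsi => hW ?_⟩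
      · have h1 := Submodule.finrank_mono (hW hle)
        simp only [finrank_toSub, gridDim_castSucc] at h1 ⊢
        simp only [delta, Fin.cases_succ]
        omega
      · have h1 := hV.1 hle
        simp only at h1
        rwa [hV.2 (i.castSucc, j.castSucc) (by simp [memT])] at h1
      · have h1 := hsi.1
        have h2 := hsi.2
        simp only [memT, Fin.le_def, Fin.val_succ, Fin.val_castSucc] at hs h1 h2
        constructor <;> simp only [Fin.le_def, Fin.val_castSucc] <;> omega
  have hVU : ∀ V ∈ monoFamilies W T, toSub (V (i, j.castSucc)) ≤ U := by
    intro V hV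
    have h1 : toSub (V (i, j.castSucc)) ≤ toSub (V (i, j.succ)) :=
      hV.1 ⟨le_rfl, Fin.castSucc_le_succ j⟩
    rwa [hV.2 (i, j.succ) (by simp [memT])] at h1
  have hWmem : (W : ∀ a, grass K A (gridDim κ d a)) ∈ monoFamilies W T := ⟨hW, fun _ _ => rfl⟩
  have hLU : L ≤ U := (hLW W hWmem).trans (hVU W hWmem)
  have hU : Module.finrank K U = nextCol κ d j i := by
    rw [finrank_toSub, gridDim_succ]
  have hκU : κ i j ≤ nextCol κ d j i := by
    have := Submodule.finrank_mono (hVU W hWmem)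
    rwa [finrank_toSub, gridDim_castSucc, hU] at this
  obtain ⟨f, r, hrf, hrL, hfU, hfr⟩ := exists_interval_splitting hLU
    (N := delta κ i j + epsilon κ d i j) (by rw [hU, epsilon]; omega)
  have hf : Function.Injective f := Function.LeftInverse.injective hrf
  have hsup : ∀ S : Submodule K A, L ≤ S → S ≤ U → (S.map r).map f ⊔ L = S := by
    intro S hLS hSU
    refine le_antisymm (sup_le ?_ hLS) fun x hx => ?_
    · rintro _ ⟨_, ⟨x, hx, rfl⟩, rfl⟩
      have := sub_mem hx (hLS (hfr x (hSU hx)))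
      simpa using this
    · exact Submodule.mem_sup.2 ⟨f (r x), ⟨r x, ⟨x, hx, rfl⟩, rfl⟩, x - f (r x), hfr x (hSU hx),
        by simp⟩
  have hdim : ∀ S : Submodule K (Fin (delta κ i j + epsilon κ d i j) → K),
      Module.finrank K (S.map f ⊔ L : Submodule K A) =
        Module.finrank K L + Module.finrank K S := by
    intro S
    have h1 := Submodule.finrank_sup_add_finrank_inf_eq (S.map f) L
    have h2 : S.map f ⊓ L = ⊥ := by
      refine eq_bot_iff.2 ?_
      rintro _ ⟨⟨x, hx, rfl⟩, hL⟩
      have := hrL _ hL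
      rw [hrf] at this
      simp [this]
    rw [h2, finrank_bot, finrank_map_of_injective hf] at h1
    omega
  let p : X → grassN K (delta κ i j) (delta κ i j + epsilon κ d i j) := fun V =>
    ofSub ((toSub ((V : monoFamilies W T).1 (i, j.castSucc))).map r) (by
      have h1 := hdim ((toSub ((V : monoFamilies W T).1 (i, j.castSucc))).map r)
      rw [hsup _ (hLW _ (V : monoFamilies W T).2) (hVU _ (V : monoFamilies W T).2),
        finrank_toSub] at h1
      have h2 : gridDim κ d (i, j.castSucc) = κ i j := gridDim_castSucc i j
      omega)
  let c : Fin (m + 2) → Fin (m + 1) × Fin (n + 2) := fun q =>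
    if h : q.val ≤ i.val then (⟨q.val, by omega⟩, j.castSucc) else (⟨q.val - 1, by omega⟩, j.succ)
  have hci : c i.castSucc = (i, j.castSucc) := by simp [c]
  have hcT : ∀ q, q ≠ i.castSucc → c q ∉ T := by
    intro q hq
    have hq' : q.val ≠ i.val := fun h => hq (Fin.ext h)
    rw [memT]
    by_cases h : q.val ≤ i.val
    · simp only [c, dif_pos h, Fin.le_def, Fin.val_castSucc]
      omega
    · simp only [c, dif_neg h, Fin.le_def, Fin.val_succ]
      omega
  have hcmono : Monotone c := by
    intro q q' hq
    have hq' : q.val ≤ q'.val := hq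
    by_cases h : q.val ≤ i.val <;> by_cases h' : q'.val ≤ i.val
    · simp only [c, dif_pos h, dif_pos h']
      exact ⟨hq', le_rfl⟩
    · simp only [c, dif_pos h, dif_neg h']
      exact ⟨by simp only [Fin.le_def]; omega, Fin.castSucc_le_succ j⟩
    · omega
    · simp only [c, dif_neg h, dif_neg h']
      exact ⟨by simp only [Fin.le_def]; omega, le_rfl⟩
  let σ : ∀ q, grassN K (delta κ i j) (delta κ i j + epsilon κ d i j) → Submodule K A :=
    fun q b => if q = i.castSucc then (toSub b).map f ⊔ L else toSub (W (c q))
  have hσi : ∀ b, σ i.castSucc b = (toSub b).map f ⊔ L := fun b => if_pos rfl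
  have hσq : ∀ q b, q ≠ i.castSucc → σ q b = toSub (W (c q)) := fun q b hq => if_neg hq
  let β : ∀ q, grassN K (delta κ i j) (delta κ i j + epsilon κ d i j) →
      grass K A (gridDim κ d (c q)) := fun q b => ofSub (σ q b) (by
    by_cases hq : q = i.castSucc
    · subst hq
      rw [hσi, hdim, finrank_toSub, hLdim, hci, gridDim_castSucc]
    · rw [hσq q b hq, finrank_toSub])
  have hup : ∀ b q, ∀ s ∉ T, c q ≤ s → σ q b ≤ toSub (W s) := by
    intro b q s hs hqs
    by_cases hq : q = i.castSucc
    · subst hq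
      rw [hci] at hqs
      have h1 : U ≤ toSub (W s) := by
        refine hW ⟨hqs.1, ?_⟩
        have h1 := hqs.1
        have h2 := hqs.2
        simp only [memT, Fin.le_def, Fin.val_castSucc, Fin.val_succ] at hs h1 h2 ⊢
        omega
      rw [hσi]
      refine le_trans (sup_le ?_ hLU) h1
      rintro _ ⟨x, -, rfl⟩
      exact hfU x
    · rw [hσq q b hq]
      exact hW hqs
  have hdown : ∀ b q, ∀ s ∉ T, s ≤ c q → toSub (W s) ≤ σ q b := by
    intro b q s hs hqs
    by_cases hq : q = i.castSucc
    · subst hq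
      rw [hci] at hqs
      rw [hσi]
      exact (hWL s hs hqs).trans le_sup_right
    · rw [hσq q b hq]
      exact hW hqs
  refine ⟨p, ?_⟩
  have key := isLocallyTrivial_monoFamilies hW (T := T) (c := c) (β := β)
    (p := p) (fun q b => ?_) (fun b q q' h => ?_) (fun b b' h => ?_) hup hdown
    (fun a ha s hs has => ?_) (fun s hs a ha has => ?_) ?_ (fun V q => ?_)
  · convert key using 4
    ext a
    rw [Set.mem_sdiff, memT, Set.mem_range]
    constructor
    · intro h
      have h' : a.2.val < j.val ∨ a.2.val = j.val ∧ i < a.1 := h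
      refine ⟨h'.imp_right fun h => ⟨h.1, h.2.le⟩, ?_⟩
      rintro ⟨q, rfl⟩
      by_cases hq : q = i.castSucc
      · subst hq
        rw [hci] at h'
        simp at h'
      · exact hcT q hq ((memT _).2 (h'.imp_right fun h => ⟨h.1, h.2.le⟩))
    · rintro ⟨h | ⟨h, h'⟩, h2⟩
      · exact Or.inl h
      · refine Or.inr ⟨h, lt_of_le_of_ne h' ?_⟩
        rintro rfl
        exact h2 ⟨_, hci.trans (Prod.ext rfl (Fin.ext h.symm))⟩
  · by_cases hq : q = i.castSucc
    · exact (morphAt_id b).map_sup (regMap_const f b) L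
        (Eventually.of_forall fun b => if_pos hq)
    · exact (morphAt_const (W (c q)) b).congr
        (Eventually.of_forall fun b => toSub_injective (hσq q b hq).symm)
  · change σ q b ≤ σ q' b
    by_cases hq : q = i.castSucc
    · by_cases hq' : q' = i.castSucc
      · rw [hq, hq']
      · rw [hσq q' b hq']
        exact hup b q _ (hcT q' hq') (hcmono h)
    · rw [hσq q b hq]
      exact hdown b q' _ (hcT q hq) (hcmono h)
  · have h1 : (toSub b).map f ⊔ L = (toSub b').map f ⊔ L := by
      rw [← hσi, ← hσi]
      exact congr_arg toSub (h i.castSucc)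
    have h2 : ∀ b : grassN K (delta κ i j) (delta κ i j + epsilon κ d i j),
        ((toSub b).map f ⊔ L).map r = toSub b := by
      intro b
      have h3 : L.map r = ⊥ := eq_bot_iff.2 (by
        rintro _ ⟨x, hx, rfl⟩
        exact hrL x hx)
      have h4 : r ∘ₗ f = LinearMap.id := LinearMap.ext hrf
      rw [Submodule.map_sup, h3, sup_bot_eq, ← Submodule.map_comp, h4, Submodule.map_id]
    exact toSub_injective (by rw [← h2 b, ← h2 b', h1])
  · have h1 := has.1
    have h2 := has.2
    simp only [memT, Fin.le_def] at ha hs h1 h2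
    by_cases h : i.val ≤ a.1.val ∧ j.val < s.2.val
    · refine ⟨⟨a.1.val + 1, by omega⟩, ?_⟩
      have h3 : ¬ a.1.val + 1 ≤ i.val := by omega
      simp only [c, dif_neg h3]
      refine ⟨⟨?_, ?_⟩, ⟨?_, ?_⟩⟩ <;>
        simp only [Fin.le_def, Fin.val_succ] <;> omega
    · refine ⟨⟨a.1.val, by omega⟩, ?_⟩
      have h3 : a.1.val ≤ i.val := by omega
      simp only [c, dif_pos h3]
      refine ⟨⟨?_, ?_⟩, ⟨?_, ?_⟩⟩ <;>
        simp only [Fin.le_def, Fin.val_castSucc] <;> omega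
  · have h1 := has.1
    have h2 := has.2
    simp only [memT, Fin.le_def] at ha hs h1 h2
    refine ⟨⟨s.1.val, by omega⟩, ?_⟩
    have h3 : s.1.val ≤ i.val := by omega
    simp only [c, dif_pos h3]
    refine ⟨⟨?_, ?_⟩, ⟨?_, ?_⟩⟩ <;>
      simp only [Fin.le_def, Fin.val_castSucc] <;> omega
  · refine isMorphism_iff.2 fun V => ?_
    have h1 := (morphAt_apply (i, j.castSucc) _).comp (morphAt_val V)
    exact h1.map r (Eventually.of_forall fun _ => rfl)
  · refine toSub_injective ?_
    change σ q (p V) = _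
    by_cases hq : q = i.castSucc
    · subst hq
      rw [hσi]
      have h1 : toSub (V.1 (c i.castSucc)) = toSub (V.1 (i, j.castSucc)) := by rw [hci]
      rw [h1]
      exact hsup _ (hLW _ V.2) (hVU _ V.2)
    · rw [hσq _ _ hq, V.2.2 _ (hcT q hq)]

end Stages

/-! ### The doubly indexed flag variety as a variety of monotone families -/

section DoubleFlag

variable {m n : ℕ} {κ : Fin (m + 1) → Fin (n + 1) → ℕ} {d : Fin (m + 1) → ℕ}
  {A : Type w} [AddCommGroup A] [Module K A] [FiniteDimensional K A]

/-- A point of the doubly indexed flag variety, together with the ambient flag in the last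
column. -/
theorem exists_grid_point {As : Fin (m + 1) → Submodule K A} (hAs : Monotone As)
    (hd : ∀ i, Module.finrank K (As i) = d i) (hκd : ∀ i j, κ i j ≤ d i)
    (hκ : ∀ i i' j j', i ≤ i' → j ≤ j' → κ i j ≤ κ i' j') :
    ∃ W : ∀ a, grass K A (gridDim κ d a), Monotone (fun a => toSub (W a)) ∧
      ∀ i, toSub (W (i, Fin.last (n + 1))) = As i := by
  obtain ⟨E, hE, hdim, hES⟩ := exists_complete_flag hAs
  have hdm : Monotone d := fun i i' h => by
    rw [← hd, ← hd]
    exact Submodule.finrank_mono (hAs h)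
  have hmono := gridDim_mono hdm hκd hκ
  have hle : ∀ a, gridDim κ d a ≤ Module.finrank K A := by
    rintro ⟨i, j⟩
    refine (hmono (⟨le_rfl, Fin.le_last j⟩ : (i, j) ≤ (i, Fin.last (n + 1)))).trans ?_
    rw [gridDim_last, ← hd]
    exact Submodule.finrank_le _
  refine ⟨fun a => ofSub (E (gridDim κ d a)) (hdim _ (hle a)), fun a a' h => hE (hmono h),
    fun i => ?_⟩
  rw [toSub_ofSub, gridDim_last, ← hd]
  exact hES i

/-- A subspace of `A` contained in `A_i` is the same as a subspace of `A_i`. Both directions are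
morphisms, since images under linear maps are: pulling back to `A_i` is taking the image under a
retraction of `A` onto `A_i`. -/
theorem isomorphic_doubleFlag {As : Fin (m + 1) → Submodule K A}
    {W : ∀ a, grass K A (gridDim κ d a)} (hWm : Monotone fun a => toSub (W a))
    (hW : ∀ i, toSub (W (i, Fin.last (n + 1))) = As i) :
    Isomorphic ((Space.pi fun a => grass K A (gridDim κ d a)).sub
      (monoFamilies W {a | a.2.val < n + 1})) (doubleFlag As κ) := by
  let T : Set (Fin (m + 1) × Fin (n + 2)) := {a | a.2.val < n + 1}
  let P := Space.pi fun a => grass K A (gridDim κ d a)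
  have hd : ∀ i, Module.finrank K (As i) = d i := fun i => by
    rw [← hW, finrank_toSub, gridDim_last]
  have hlast : ∀ V ∈ monoFamilies W T, ∀ i, toSub (V (i, Fin.last (n + 1))) = As i := by
    intro V hV i
    rw [hV.2 (i, Fin.last (n + 1)) (by simp [T]), hW]
  have hle : ∀ V ∈ monoFamilies W T, ∀ i j, toSub (V (i, j)) ≤ As i := by
    intro V hV i j
    rw [← hlast V hV i]
    exact hV.1 ⟨le_rfl, Fin.le_last j⟩
  choose r hr using fun i => (As i).subtype.exists_leftInverse_of_injective (As i).ker_subtype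
  have hcomap : ∀ i, ∀ S ≤ As i, S.comap (As i).subtype = S.map (r i) := by
    intro i S hS
    have h1 : ∀ x : As i, r i x = x := fun x => LinearMap.congr_fun (hr i) x
    ext x
    constructor
    · exact fun hx => ⟨x, hx, h1 x⟩
    · rintro ⟨y, hy, rfl⟩
      have := h1 ⟨y, hS hy⟩
      simp only at this
      rw [this]
      exact hy
  let D := doubleFlag As κ
  let σ : D → Fin (m + 1) × Fin (n + 2) → Submodule K A := fun U a =>
    Fin.lastCases (motive := fun _ => Submodule K A) (As a.1)
      (fun j => (U.1 (a.1, j)).1.map (As a.1).subtype) a.2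
  have hσl : ∀ U i, σ U (i, Fin.last (n + 1)) = As i := fun U i => by simp [σ]
  have hσc : ∀ U i j, σ U (i, Fin.castSucc j) = (U.1 (i, j)).1.map (As i).subtype :=
    fun U i j => by simp [σ]
  have hσd : ∀ U a, Module.finrank K (σ U a) = gridDim κ d a := by
    rintro U ⟨i, j⟩
    induction j using Fin.lastCases with
    | last => rw [hσl, gridDim_last, hd]
    | cast j =>
      rw [hσc, gridDim_castSucc, finrank_map_of_injective (As i).subtype_injective]
      exact (U.1 (i, j)).2
  have hσle : ∀ U i j, σ U (i, j) ≤ As i := by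
    intro U i j
    induction j using Fin.lastCases with
    | last => rw [hσl]
    | cast j =>
      rw [hσc]
      exact Submodule.map_subtype_le _ _
  have hAs : Monotone As := fun i i' h => by
    rw [← hW, ← hW]
    exact hWm ⟨h, le_rfl⟩
  have hσm : ∀ U, Monotone (σ U) := by
    rintro U ⟨i, j⟩ ⟨i', j'⟩ ⟨hi, hj⟩
    simp only at hi hj
    induction j' using Fin.lastCases with
    | last =>
      rw [hσl]
      exact (hσle U i j).trans (hAs hi)
    | cast j' =>
      induction j using Fin.lastCases with
      | last => exact absurd hj (Fin.castSucc_lt_last j').not_ge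
      | cast j =>
        rw [hσc, hσc]
        exact U.2 i i' j j' hi (by simpa using hj)
  let e : P.sub (monoFamilies W T) ≃ D :=
    { toFun := fun V => ⟨fun a =>
        ⟨(toSub ((V : monoFamilies W T).1 (a.1, a.2.castSucc))).comap (As a.1).subtype, by
          have h1 := (Submodule.comapSubtypeEquivOfLe
            (hle _ (V : monoFamilies W T).2 a.1 a.2.castSucc)).finrank_eq
          exact h1.trans ((finrank_toSub _).trans (gridDim_castSucc _ _))⟩,
        fun i i' j j' hi hj => by
          have h1 := hle _ (V : monoFamilies W T).2
          rw [Submodule.map_comap_subtype, Submodule.map_comap_subtype,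
            inf_eq_right.2 (h1 _ _), inf_eq_right.2 (h1 _ _)]
          exact (V : monoFamilies W T).2.1 ⟨hi, Fin.castSucc_le_castSucc_iff.2 hj⟩⟩
      invFun := fun U => (⟨fun a => ofSub (σ U a) (hσd U a), hσm U, fun s hs => by
          obtain ⟨i, j⟩ := s
          have hj : j = Fin.last (n + 1) := by
            simp only [T, Set.mem_ofPred_eq, not_lt] at hs
            exact Fin.ext (le_antisymm (Nat.lt_succ_iff.1 j.2) hs)
          subst hj
          exact toSub_injective ((hσl U i).trans (hW i).symm)⟩ : monoFamilies W T)
      left_inv := fun V => Subtype.ext (funext fun ⟨i, j⟩ => toSub_injective (by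
        induction j using Fin.lastCases with
        | last => exact (hσl _ i).trans (hlast _ (V : monoFamilies W T).2 i).symm
        | cast j =>
          refine (hσc _ i j).trans ?_
          exact (Submodule.map_comap_subtype _ _).trans
            (inf_eq_right.2 (hle _ (V : monoFamilies W T).2 _ _))))
      right_inv := fun U => Subtype.ext (funext fun ⟨i, j⟩ => Subtype.ext (by
        refine (congr_arg (Submodule.comap (As i).subtype) (hσc U i j)).trans ?_
        exact Submodule.comap_map_eq_of_injective (As i).subtype_injective _)) }
  refine ⟨e, isIso_iff.2 ⟨fun V => ?_, fun U => ?_⟩⟩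
  · refine morphAt_sub (morphAt_pi fun a => ?_)
    have h1 := (morphAt_apply (a.1, a.2.castSucc) _).comp (morphAt_val V)
    exact h1.map (r a.1) (Eventually.of_forall fun V =>
      hcomap a.1 _ (hle _ (V : monoFamilies W T).2 a.1 a.2.castSucc))
  · refine morphAt_sub (morphAt_pi fun ⟨i, j⟩ => ?_)
    induction j using Fin.lastCases with
    | last => exact (morphAt_const (W (i, Fin.last (n + 1))) U).congr (Eventually.of_forall fun U =>
        toSub_injective ((hW i).trans (hσl U i).symm))
    | cast j =>
      have h1 := (morphAt_apply (i, j) _).comp (morphAt_val U)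
      exact h1.map (As i).subtype (Eventually.of_forall fun U => hσc U i j)

theorem isIteratedBundle_columns {W : ∀ a, grass K A (gridDim κ d a)}
    (hW : Monotone fun a => toSub (W a)) :
    IsIteratedBundle ((Space.pi fun a => grass K A (gridDim κ d a)).sub
      (monoFamilies W {a | a.2.val < n + 1}))
      ((List.finRange (n + 1)).map fun j => schubertN K (fun i => κ i j) (nextCol κ d j)) := by
  have h := isIteratedBundle_tower (T := fun t => (Space.pi fun a => grass K A (gridDim κ d a)).sub
      (monoFamilies W {a | a.2.val < t})) (fun t => isVariety_pi_grass (isClosed_monoFamilies W _))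
    (⟨W, hW, fun _ _ => rfl⟩ : monoFamilies W _)
    (fun V => Subtype.ext (funext fun a =>
      (V : monoFamilies W {a | a.2.val < 0}).2.2 a (Nat.not_lt_zero _)))
    ((List.finRange (n + 1)).map fun j => schubertN K (fun i => κ i j) (nextCol κ d j))
    (by simp) (fun B hB => ?_) (fun t ht => ?_)
  · simpa using h
  · obtain ⟨j, -, rfl⟩ := List.mem_map.1 hB
    exact isVariety_schubert _ _
  · rw [List.getElem_map, List.getElem_finRange]
    exact exists_isLocallyTrivial_column hW ⟨t, by simpa using ht⟩

/-- The list of the entries column by column, each column from the bottom row to the top one, with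
the `t`-th member of the list given explicitly. -/
theorem flatMap_reverse_eq_ofFn {α : Type*} (G : Fin (m + 1) → Fin (n + 1) → α) :
    ((List.finRange (n + 1)).flatMap fun j => (List.finRange (m + 1)).reverse.map fun i => G i j) =
      List.ofFn fun t : Fin ((n + 1) * (m + 1)) => G t.modNat.rev t.divNat := by
  rw [List.ofFn_mul, List.flatMap, List.ofFn_eq_map]
  congr 1
  refine List.map_congr_left fun j _ => ?_
  rw [List.finRange_reverse, List.map_map, List.ofFn_eq_map]
  refine List.map_congr_left fun i _ => ?_
  have hdiv : (j.val * (m + 1) + i.val) / (m + 1) = j.val := by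
    rw [Nat.add_comm, Nat.add_mul_div_right _ _ (Nat.succ_pos m), Nat.div_eq_of_lt i.2, zero_add]
  have hmod : (j.val * (m + 1) + i.val) % (m + 1) = i.val := by
    rw [Nat.add_comm, Nat.add_mul_mod_self_right, Nat.mod_eq_of_lt i.2]
  exact congr_arg₂ G (congr_arg Fin.rev (Fin.ext hmod.symm)) (Fin.ext hdiv.symm)

/-- The order of the positions `(i, j)` by their numbers `j (m + 1) + (m - i)`. -/
theorem mul_add_lt_iff {m x y i j : ℕ} (hx : x ≤ m) (hi : i ≤ m) :
    y * (m + 1) + (m - x) < j * (m + 1) + (m - i) ↔ y < j ∨ y = j ∧ i < x := by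
  rcases lt_trichotomy y j with h | rfl | h
  · have h1 := Nat.mul_le_mul_right (m + 1) (Nat.succ_le_of_lt h)
    rw [Nat.succ_mul] at h1
    generalize y * (m + 1) = P at *
    generalize j * (m + 1) = Q at *
    omega
  · omega
  · have h1 := Nat.mul_le_mul_right (m + 1) (Nat.succ_le_of_lt h)
    rw [Nat.succ_mul] at h1
    generalize y * (m + 1) = P at *
    generalize j * (m + 1) = Q at *
    omega

theorem isIteratedBundle_entries {W : ∀ a, grass K A (gridDim κ d a)}
    (hW : Monotone fun a => toSub (W a)) :
    IsIteratedBundle ((Space.pi fun a => grass K A (gridDim κ d a)).sub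
      (monoFamilies W {a | a.2.val < n + 1}))
      ((List.finRange (n + 1)).flatMap fun j => (List.finRange (m + 1)).reverse.map fun i =>
        grassN K (delta κ i j) (delta κ i j + epsilon κ d i j)) := by
  rw [flatMap_reverse_eq_ofFn fun i j =>
    grassN K (delta κ i j) (delta κ i j + epsilon κ d i j)]
  -- the position `(i, j)` is number `j (m + 1) + (m - i)` in the order of the list
  have h := isIteratedBundle_tower (T := fun t => (Space.pi fun a => grass K A (gridDim κ d a)).sub
      (monoFamilies W {a | a.2.val * (m + 1) + (m - a.1.val) < t}))
    (fun t => isVariety_pi_grass (isClosed_monoFamilies W _))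
    (⟨W, hW, fun _ _ => rfl⟩ : monoFamilies W _)
    (fun V => Subtype.ext (funext fun a =>
      (V : monoFamilies W {a | a.2.val * (m + 1) + (m - a.1.val) < 0}).2.2 a (Nat.not_lt_zero _)))
    (List.ofFn fun t : Fin ((n + 1) * (m + 1)) =>
      grassN K (delta κ t.modNat.rev t.divNat)
        (delta κ t.modNat.rev t.divNat + epsilon κ d t.modNat.rev t.divNat))
    (by simp) (fun B hB => ?_) (fun t ht => ?_)
  · rw [List.length_ofFn] at h
    have e : {a : Fin (m + 1) × Fin (n + 2) | a.2.val < n + 1} =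
        {a | a.2.val * (m + 1) + (m - a.1.val) < (n + 1) * (m + 1)} := ?_
    · rwa [e]
    ext a
    have h1 := mul_add_lt_iff (y := a.2.val) (j := n + 1) (Nat.lt_succ_iff.1 a.1.2) le_rfl
    rw [Nat.sub_self, add_zero] at h1
    simp only [Set.mem_ofPred_eq, h1]
    have h2 := a.1.2
    omega
  · obtain ⟨t, rfl⟩ := List.mem_ofFn.1 hB
    exact isVariety_grass _
  · rw [List.getElem_ofFn]
    rw [List.length_ofFn] at ht
    set j : Fin (n + 1) := Fin.divNat (⟨t, ht⟩ : Fin ((n + 1) * (m + 1)))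
    set i : Fin (m + 1) := (Fin.modNat (⟨t, ht⟩ : Fin ((n + 1) * (m + 1)))).rev with hi
    have ht' : t = j.val * (m + 1) + (m - i.val) := by
      have h1 := Nat.div_add_mod' t (m + 1)
      have h2 := Nat.mod_lt t (show 0 < m + 1 by omega)
      have h3 : i.val = m + 1 - (t % (m + 1) + 1) := by simp [hi, Fin.val_rev]
      have h4 : j.val = t / (m + 1) := rfl
      rw [h4, h3]
      omega
    have him : i.val ≤ m := Nat.lt_succ_iff.1 i.2
    have key := exists_isLocallyTrivial_entry hW i j
    have e1 : {a : Fin (m + 1) × Fin (n + 2) | a.2.val < j.val ∨ a.2.val = j.val ∧ i ≤ a.1} =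
        {a | a.2.val * (m + 1) + (m - a.1.val) < t + 1} := by
      ext a
      have h2 := mul_add_lt_iff (y := j.val) (j := a.2.val) him (Nat.lt_succ_iff.1 a.1.2)
      simp only [Set.mem_ofPred_eq]
      rw [Nat.lt_succ_iff, ht', ← not_lt (a := j.val * (m + 1) + (m - i.val)), h2, Fin.le_def]
      omega
    have e2 : {a : Fin (m + 1) × Fin (n + 2) | a.2.val < j.val ∨ a.2.val = j.val ∧ i < a.1} =
        {a | a.2.val * (m + 1) + (m - a.1.val) < t} := by
      ext a
      rw [ht']
      exact (mul_add_lt_iff (Nat.lt_succ_iff.1 a.1.2) him).symm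
    rw [e1, e2] at key
    exact key

end DoubleFlag

/-! ### Smoothness -/

section Smooth

variable {X : Space.{u, v} K} {Y : Space.{u, w} K} {Z : Space.{u, w'} K}

/-- The germs of `X` at `x` and of `Y` at `y` are isomorphic. The two maps are only relevant near
`x` and `y`. -/
def GermIso (X : Space.{u, v} K) (x : X) (Y : Space.{u, w} K) (y : Y) : Prop :=
  ∃ (φ : X → Y) (ψ : Y → X), φ x = y ∧ ψ y = x ∧ MorphAt X Y φ x ∧ MorphAt Y X ψ y ∧
    (∀ᶠ x' in 𝓝 x, ψ (φ x') = x') ∧ ∀ᶠ y' in 𝓝 y, φ (ψ y') = y'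

theorem GermIso.symm {x : X} {y : Y} (h : GermIso X x Y y) : GermIso Y y X x := by
  obtain ⟨φ, ψ, h1, h2, h3, h4, h5, h6⟩ := h
  exact ⟨ψ, φ, h2, h1, h4, h3, h6, h5⟩

theorem GermIso.trans {x : X} {y : Y} {z : Z} (h : GermIso X x Y y) (h' : GermIso Y y Z z) :
    GermIso X x Z z := by
  obtain ⟨φ, ψ, rfl, h2, h3, h4, h5, h6⟩ := h
  obtain ⟨φ', ψ', rfl, h2', h3', h4', h5', h6'⟩ := h'
  refine ⟨fun x => φ' (φ x), fun z => ψ (ψ' z), rfl, (congr_arg ψ h2').trans h2, h3'.comp h3,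
    MorphAt.comp (by rwa [h2']) h4', ?_, ?_⟩
  · filter_upwards [h5, h3.1.eventually h5'] with x' hx hx'
    rw [hx', hx]
  · have h7 : ∀ᶠ y' in 𝓝 (ψ' (φ' (φ x))), φ (ψ y') = y' := by rwa [h2']
    filter_upwards [h6', h4'.1.eventually h7] with z' hz hz'
    rw [hz', hz]

theorem IsIso.germIso {e : X ≃ Y} (h : IsIso X Y e) (x : X) : GermIso X x Y (e x) := by
  rw [isIso_iff] at h
  exact ⟨e, e.symm, rfl, e.symm_apply_apply x, h.1 x, h.2 _,
    Eventually.of_forall e.symm_apply_apply, Eventually.of_forall e.apply_symm_apply⟩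

theorem germIso_sub {U : Set X} (hU : IsOpen U) (x : U) : GermIso (X.sub U) x X x.1 := by
  obtain ⟨ψ, hψ, h⟩ := (morphAt_id x.1).exists_sub (S := U) (hU.mem_nhds x.2)
  refine ⟨fun t : U => t.1, ψ, rfl, Subtype.ext (h _ x.2), morphAt_val x, hψ,
    Eventually.of_forall fun t => Subtype.ext (h _ (t : U).2), ?_⟩
  filter_upwards [hU.mem_nhds x.2] with y hy using h y hy

theorem GermIso.prod {X' : Space.{u, v'} K} {Y' : Space.{u, w''} K} {x : X} {y : Y} {x' : X'}
    {y' : Y'} (h : GermIso X x Y y) (h' : GermIso X' x' Y' y') :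
    GermIso (X.prod X') (x, x') (Y.prod Y') (y, y') := by
  obtain ⟨φ, ψ, rfl, h2, h3, h4, h5, h6⟩ := h
  obtain ⟨φ', ψ', rfl, h2', h3', h4', h5', h6'⟩ := h'
  have hf : ∀ z : X.prod X', MorphAt _ _ (fun z : X × X' => z.1) z := morphAt_fst
  have hs : ∀ z : X.prod X', MorphAt _ _ (fun z : X × X' => z.2) z := morphAt_snd
  have hf' : ∀ z : Y.prod Y', MorphAt _ _ (fun z : Y × Y' => z.1) z := morphAt_fst
  have hs' : ∀ z : Y.prod Y', MorphAt _ _ (fun z : Y × Y' => z.2) z := morphAt_snd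
  have h7 : MorphAt (Y.prod Y') X (fun z : Y × Y' => ψ z.1) (φ x, φ' x') :=
    MorphAt.comp (X := Y.prod Y') (φ := fun z : Y × Y' => z.1) (x := (φ x, φ' x')) h4 (hf' _)
  have h8 : MorphAt (Y.prod Y') X' (fun z : Y × Y' => ψ' z.2) (φ x, φ' x') :=
    MorphAt.comp (X := Y.prod Y') (φ := fun z : Y × Y' => z.2) (x := (φ x, φ' x')) h4' (hs' _)
  refine ⟨fun z => (φ z.1, φ' z.2), fun z => (ψ z.1, ψ' z.2), rfl, Prod.ext h2 h2',
    morphAt_prod (h3.comp (hf (x, x'))) (h3'.comp (hs (x, x'))),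
    morphAt_prod h7 h8, ?_, ?_⟩
  · filter_upwards [(hf (x, x')).1.eventually h5, (hs (x, x')).1.eventually h5'] with z hz hz'
    exact Prod.ext hz hz'
  · filter_upwards [(hf' (φ x, φ' x')).1.eventually h6, (hs' (φ x, φ' x')).1.eventually h6']
      with z hz hz'
    exact Prod.ext hz hz'

/-- Near each of its points, `X` is isomorphic to an affine space. -/
def LocallyAffineSpace (X : Space.{u, v} K) : Prop :=
  ∀ x : X, ∃ (N : ℕ) (y : affineSpace K (Fin N → K)), GermIso X x (affineSpace K (Fin N → K)) y

theorem exists_germIso_affineSpace {W : Type v'} [AddCommGroup W] [Module K W]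
    [FiniteDimensional K W] (w : affineSpace K W) :
    ∃ (N : ℕ) (y : affineSpace K (Fin N → K)),
      GermIso (affineSpace K W) w (affineSpace K (Fin N → K)) y := by
  let e := (Module.finBasis K W).equivFun
  have he : IsIso (affineSpace K W) (affineSpace K (Fin (Module.finrank K W) → K)) e.toEquiv :=
    isIso_iff.2 ⟨fun w => morphAt_affineSpace.2 ((regMap_id w).linear e.toLinearMap),
      fun w => morphAt_affineSpace.2 ((regMap_id w).linear e.symm.toLinearMap)⟩
  exact ⟨_, _, he.germIso w⟩

theorem LocallyAffineSpace.of_isLocallyTrivial {B : Space.{u, w} K} {F : Space.{u, v} K}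
    {p : X → B} (h : IsLocallyTrivial X B F p) (hB : LocallyAffineSpace B)
    (hF : LocallyAffineSpace F) : LocallyAffineSpace X := by
  intro x
  obtain ⟨U, hU, hx, e, he, -⟩ := h.2 (p x)
  have hU' : IsOpen (p ⁻¹' U) := hU.preimage h.1.1
  obtain ⟨⟨b, f⟩, hbf⟩ : ∃ z : U × F, e (⟨x, hx⟩ : (p ⁻¹' U : Set X)) = z := ⟨_, rfl⟩
  obtain ⟨N, y, hy⟩ := hB (b : U).1
  obtain ⟨N', y', hy'⟩ := hF f
  have h1 : GermIso X x ((B.sub U).prod F) (b, f) := by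
    have := (germIso_sub hU' ⟨x, hx⟩).symm.trans (he.germIso _)
    rwa [hbf] at this
  have h2 := h1.trans (((germIso_sub hU b).trans hy).prod hy')
  let e' : (affineSpace K (Fin N → K)).prod (affineSpace K (Fin N' → K)) ≃
      affineSpace K ((Fin N → K) × (Fin N' → K)) := Equiv.refl _
  have he' : IsIso ((affineSpace K (Fin N → K)).prod (affineSpace K (Fin N' → K)))
      (affineSpace K ((Fin N → K) × (Fin N' → K))) e' := by
    refine isIso_iff.2 ⟨fun z => morphAt_affineSpace.2 ?_, fun z => morphAt_prod ?_ ?_⟩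
    · have h3 := ((regMap_id _).comp (morphAt_fst z)).linear
        (LinearMap.inl K (Fin N → K) (Fin N' → K))
      have h4 := ((regMap_id _).comp (morphAt_snd z)).linear
        (LinearMap.inr K (Fin N → K) (Fin N' → K))
      refine (h3.add h4).congr (Eventually.of_forall fun z => ?_)
      exact Prod.ext (add_zero _) (zero_add _)
    · exact morphAt_affineSpace.2
        ((regMap_id z).linear (LinearMap.fst K (Fin N → K) (Fin N' → K)))
    · exact morphAt_affineSpace.2
        ((regMap_id z).linear (LinearMap.snd K (Fin N → K) (Fin N' → K)))
  obtain ⟨N'', y'', h3⟩ := exists_germIso_affineSpace (e' (y, y'))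
  exact ⟨N'', y'', h2.trans ((he'.germIso _).trans h3)⟩

theorem IsIteratedBundle.locallyAffineSpace {L : List (Space.{u, w} K)}
    (h : IsIteratedBundle X L) (hL : ∀ B ∈ L, LocallyAffineSpace B) : LocallyAffineSpace X := by
  induction h with
  | iso hX hB h =>
    intro x
    obtain ⟨e, he⟩ := h
    obtain ⟨N, y, hy⟩ := hL _ (by simp) (e x)
    exact ⟨N, y, (he.germIso x).trans hy⟩
  | bundle hX hB p hp hF ih =>
    exact .of_isLocallyTrivial hp (hL _ (by simp)) (ih fun B hB => hL B (by simp [hB]))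

/-- The standard charts of the Grassmannian: `V` corresponds to the displacement of its chart frame
from that of a fixed point, which is a family of vectors in the kernel of `π`. -/
theorem locallyAffineSpace_grass {A : Type w} [AddCommGroup A] [Module K A] [FiniteDimensional K A]
    (k : ℕ) : LocallyAffineSpace (grass K A k) := by
  intro V₀
  obtain ⟨π, hπ⟩ := exists_transversal V₀
  let W := Fin k → LinearMap.ker π
  obtain ⟨ρ, hρ⟩ := (LinearMap.ker π).subtype.exists_leftInverse_of_injective
    (LinearMap.ker π).ker_subtype
  have hρ' : ∀ x (hx : x ∈ LinearMap.ker π), ρ x = ⟨x, hx⟩ := fun x hx =>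
    LinearMap.congr_fun hρ ⟨x, hx⟩
  let φ : grass K A k → affineSpace K W := fun V i => ρ (chartFrame π V i - chartFrame π V₀ i)
  let fr : W → Fin k → A := fun w i => chartFrame π V₀ i + w i
  have hfrπ : ∀ w i, π (fr w i) = Pi.single i 1 := by
    intro w i
    have h1 : π (w i) = 0 := (w i).2
    simp only [fr, map_add, h1, add_zero, hπ.apply_chartFrame]
  have hdet : ∀ w, (Matrix.of fun i j => π (fr w i) j) = 1 := by
    intro w
    ext i j
    simp [hfrπ, Matrix.one_apply, Pi.single_apply, eq_comm]
  have hdet' : ∀ w, (Matrix.of fun i j => π (fr w i) j).det ≠ 0 := by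
    intro w
    rw [hdet, Matrix.det_one]
    exact one_ne_zero
  have hli : ∀ w, LinearIndependent K (fr w) := fun w =>
    linearIndependent_of_det_ne_zero π (hdet' w)
  let ψ : affineSpace K W → grass K A k := fun w =>
    ofSub (Submodule.span K (Set.range (fr w)))
      (by rw [finrank_span_eq_card (hli w), Fintype.card_fin])
  have htr : ∀ w, Transversal π (toSub (ψ w)) := fun w =>
    (transversal_iff_det (hli w) rfl).2 (hdet' w)
  have hψ : ∀ w i, chartFrame π (ψ w) i = fr w i := fun w i =>
    (htr w).eq_of_apply_eq (chartFrame_mem π _ i) (Submodule.subset_span ⟨i, rfl⟩)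
      (((htr w).apply_chartFrame i).trans (hfrπ w i).symm)
  have hφψ : ∀ w, φ (ψ w) = w := by
    intro w
    funext i
    have h1 : φ (ψ w) i = ρ (chartFrame π (ψ w) i - chartFrame π V₀ i) := rfl
    rw [h1, hψ]
    have h2 : fr w i - chartFrame π V₀ i = (w : W) i := add_sub_cancel_left _ _
    rw [h2]
    exact hρ' _ _
  have hψφ : ∀ V : grass K A k, Transversal π (toSub V) → ψ (φ V) = V := by
    intro V hV
    refine toSub_injective ?_
    have h1 : fr (φ V) = chartFrame π V := by
      funext i
      have h2 : chartFrame π V i - chartFrame π V₀ i ∈ LinearMap.ker π := by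
        rw [LinearMap.mem_ker, map_sub, hV.apply_chartFrame, hπ.apply_chartFrame, sub_self]
      have h3 : ((φ V : W) i : A) = chartFrame π V i - chartFrame π V₀ i :=
        congr_arg Subtype.val (hρ' _ h2)
      change chartFrame π V₀ i + ((φ V : W) i : A) = _
      rw [h3, add_sub_cancel]
    have h4 : toSub (ψ (φ V)) = Submodule.span K (Set.range (fr (φ V))) := rfl
    rw [h4, h1, hV.span_chartFrame]
  have hφm : MorphAt (grass K A k) (affineSpace K W) φ V₀ := by
    refine morphAt_affineSpace.2 (regMap_pi.2 fun i => ?_)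
    exact ((regMap_pi.1 hπ.regMap_chartFrame i).sub (regMap_const _ _)).linear ρ
  have hψm : ∀ w, MorphAt (affineSpace K W) (grass K A k) ψ w := by
    intro w
    have h1 : RegMap (affineSpace K W) fr w := regMap_pi.2 fun i =>
      (regMap_const _ _).add ((regMap_pi.1 (regMap_id w) i).linear (LinearMap.ker π).subtype)
    exact morphAt_of_frame h1 (hli w) (Eventually.of_forall fun w => rfl)
  obtain ⟨N, y, hy⟩ := exists_germIso_affineSpace (φ V₀)
  refine ⟨N, y, GermIso.trans ⟨φ, ψ, rfl, hψφ V₀ hπ, hφm, hψm _, ?_,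
    Eventually.of_forall hφψ⟩ hy⟩
  filter_upwards [(isOpen_transversal π).mem_nhds hπ] with V hV using hψφ V hV

/-- Pulling back germs along maps that are inverse to each other near the limits. -/
def germRingEquiv {α β : Type*} {l : Filter α} {l' : Filter β} {φ : α → β} {ψ : β → α}
    (hφ : Tendsto φ l l') (hψ : Tendsto ψ l' l) (h : ∀ᶠ a in l, ψ (φ a) = a)
    (h' : ∀ᶠ b in l', φ (ψ b) = b) : Germ l K ≃+* Germ l' K where
  toFun f := f.compTendsto ψ hψ
  invFun f := f.compTendsto φ hφ
  left_inv f := by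
    induction f using Germ.inductionOn with
    | _ f => exact Germ.coe_eq.2 (h.mono fun a ha => congr_arg f ha)
  right_inv f := by
    induction f using Germ.inductionOn with
    | _ f => exact Germ.coe_eq.2 (h'.mono fun a ha => congr_arg f ha)
  map_mul' f g := by
    induction f using Germ.inductionOn
    induction g using Germ.inductionOn
    rfl
  map_add' f g := by
    induction f using Germ.inductionOn
    induction g using Germ.inductionOn
    rfl

/-- Isomorphic germs have isomorphic local rings. -/
theorem GermIso.ringEquiv {x : X} {y : Y} (h : GermIso X x Y y) :
    Nonempty (X.localRing x ≃+* Y.localRing y) := by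
  obtain ⟨φ, ψ, h1, h2, h3, h4, h5, h6⟩ := h
  have hφ : Tendsto φ (𝓝 x) (𝓝 y) := h1 ▸ h3.1
  have hψ : Tendsto ψ (𝓝 y) (𝓝 x) := by
    have := h4.1
    rwa [ContinuousAt, h2] at this
  let E : Germ (𝓝 x) K ≃+* Germ (𝓝 y) K := germRingEquiv hφ hψ h5 h6
  have hE : (X.localRing x).map (E : Germ (𝓝 x) K →+* Germ (𝓝 y) K) = Y.localRing y := by
    ext g
    constructor
    · rintro ⟨_, ⟨f, hf, rfl⟩, rfl⟩
      exact ⟨f ∘ ψ, h4.2 f (h2.symm ▸ hf), rfl⟩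
    · rintro ⟨f, hf, rfl⟩
      refine ⟨_, ⟨f ∘ φ, h3.2 f (h1.symm ▸ hf), rfl⟩, ?_⟩
      exact Germ.coe_eq.2 (h6.mono fun a ha => congr_arg f ha)
  exact ⟨(E.subringMap (s := X.localRing x)).trans (RingEquiv.subringCongr hE)⟩

theorem mem_polyFun_iff {N : ℕ} {f : (Fin N → K) → K} :
    f ∈ polyFun K (Fin N → K) ↔ ∃ p : MvPolynomial (Fin N) K, f = fun w => p.eval w := by
  constructor
  · intro hf
    induction hf using Algebra.adjoin_induction with
    | mem f hf =>
      obtain ⟨l, rfl⟩ := hf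
      refine ⟨∑ i, MvPolynomial.C (l (Pi.single i 1)) * MvPolynomial.X i, ?_⟩
      ext w
      simp only [map_sum, map_mul, MvPolynomial.eval_C, MvPolynomial.eval_X]
      conv_lhs => rw [pi_eq_sum_univ' w]
      simp only [map_sum, map_smul, smul_eq_mul]
      refine Finset.sum_congr rfl fun i _ => ?_
      rw [mul_comm]
    | algebraMap r => exact ⟨MvPolynomial.C r, by ext w; simp⟩
    | add f g _ _ hf hg =>
      obtain ⟨p, rfl⟩ := hf
      obtain ⟨q, rfl⟩ := hg
      exact ⟨p + q, by ext w; simp⟩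
    | mul f g _ _ hf hg =>
      obtain ⟨p, rfl⟩ := hf
      obtain ⟨q, rfl⟩ := hg
      exact ⟨p * q, by ext w; simp⟩
  · rintro ⟨p, rfl⟩
    induction p using MvPolynomial.induction_on with
    | C r =>
      simp only [MvPolynomial.eval_C]
      exact Subalgebra.algebraMap_mem _ r
    | add p q hp hq =>
      simp only [map_add]
      exact add_mem hp hq
    | mul_X p i hp =>
      simp only [map_mul, MvPolynomial.eval_X]
      exact mul_mem hp (Algebra.subset_adjoin ⟨LinearMap.proj i, rfl⟩)

/-- The local ring of the affine space at a point is a localization of the polynomial ring. -/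
theorem isRegularLocalRing_affineSpace [Infinite K] {N : ℕ} (x : affineSpace K (Fin N → K)) :
    IsRegularLocalRing ((affineSpace K (Fin N → K)).localRing x) := by
  let S := affineSpace K (Fin N → K)
  let R := MvPolynomial (Fin N) K
  have hreg : ∀ p : R, (fun w : Fin N → K => p.eval w) ∈ S.reg x := fun p =>
    let _ : TopologicalSpace (Fin N → K) := ⊤
    mem_reg_generate (T := Fin N → K) (mem_polyFun_iff.2 ⟨p, rfl⟩)
  let F : R → S → K := fun p w => p.eval (w : Fin N → K)
  let θ : R →+* S.localRing x :=
    { toFun := fun p => ⟨(F p : Germ (𝓝 x) K), F p, hreg p, rfl⟩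
      map_one' := Subtype.ext (congr_arg (fun f : S → K => (f : Germ (𝓝 x) K))
        (funext fun w => map_one _))
      map_zero' := Subtype.ext (congr_arg (fun f : S → K => (f : Germ (𝓝 x) K))
        (funext fun w => map_zero _))
      map_mul' := fun p q => Subtype.ext (congr_arg (fun f : S → K => (f : Germ (𝓝 x) K))
        (funext fun w => map_mul _ p q))
      map_add' := fun p q => Subtype.ext (congr_arg (fun f : S → K => (f : Germ (𝓝 x) K))
        (funext fun w => map_add _ p q)) }
  let I : Ideal R := RingHom.ker (MvPolynomial.eval (x : Fin N → K))
  have hI : I.IsPrime := RingHom.ker_isPrime _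
  have hmemI : ∀ p : R, p ∈ I.primeCompl ↔ p.eval (x : Fin N → K) ≠ 0 := fun p => Iff.rfl
  let _ : Algebra R (S.localRing x) := θ.toAlgebra
  have hloc : IsLocalization.AtPrime (S.localRing x) I := by
    constructor
    constructor
    · rintro ⟨p, hp⟩
      have h0 := (hmemI p).1 hp
      refine IsUnit.of_mul_eq_one ⟨_, _, S.reg_inv (hreg p) h0, rfl⟩ (Subtype.ext ?_)
      refine Germ.coe_eq.2 ?_
      filter_upwards [S.reg_ne_zero (hreg p) h0] with w hw
      exact mul_inv_cancel₀ hw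
    · rintro ⟨_, f, ⟨P, hP, Q, hQ, h0, hf⟩, rfl⟩
      obtain ⟨p, rfl⟩ := mem_polyFun_iff.1 hP
      obtain ⟨q, rfl⟩ := mem_polyFun_iff.1 hQ
      refine ⟨(p, ⟨q, (hmemI q).2 h0⟩), Subtype.ext (Germ.coe_eq.2 ?_)⟩
      have hf' : ∀ᶠ w in 𝓝 x, f w = p.eval (w : Fin N → K) / q.eval (w : Fin N → K) := hf
      filter_upwards [hf', S.reg_ne_zero (hreg q) h0] with w hw hw0
      change f w * q.eval (w : Fin N → K) = p.eval (w : Fin N → K)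
      rw [hw]
      exact div_mul_cancel₀ _ hw0
    · intro p q hpq
      have h1 : ∀ᶠ w : S in 𝓝 x, F p w = F q w :=
        Germ.coe_eq.1 (congr_arg Subtype.val hpq)
      obtain ⟨U, hUs, hU, hx⟩ := eventually_nhds_iff.1 h1
      -- `U` contains a basic open set `c ≠ 0`, so `c * p = c * q` holds at all points.
      obtain ⟨O, hO, hxO, _, hc, h0, hcU⟩ := hU x hx
      obtain ⟨c, rfl⟩ := mem_polyFun_iff.1 hc
      have hO' : O = Set.univ :=
        ((TopologicalSpace.isOpen_top_iff _).1 hO).resolve_left (Set.nonempty_of_mem hxO).ne_empty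
      refine ⟨⟨c, (hmemI c).2 h0⟩, MvPolynomial.funext fun w => ?_⟩
      rw [map_mul, map_mul]
      by_cases hw : c.eval w = 0
      · rw [hw, zero_mul, zero_mul]
      · exact congr_arg _ (hUs w (hcU w (hO' ▸ Set.mem_univ w) hw))
  have := IsRegularRing.isRegularLocalRing_localization I
  exact IsRegularLocalRing.of_ringEquiv
    (IsLocalization.algEquiv I.primeCompl (Localization.AtPrime I) (S.localRing x)).toRingEquiv

/-- Regularity of the local rings is a property of germs. -/
theorem LocallyAffineSpace.isSmooth [Infinite K] (h : LocallyAffineSpace X) (hX : X.IsVariety) :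
    X.IsSmooth := by
  refine ⟨hX, fun x => ?_⟩
  obtain ⟨N, y, hy⟩ := h x
  obtain ⟨e⟩ := hy.symm.ringEquiv
  have := isRegularLocalRing_affineSpace y
  exact IsRegularLocalRing.of_ringEquiv e

end Smooth

end FlagVar

end

theorem proposition2p2 {K : Type u} [Field K] [IsAlgClosed K] [CharZero K]
    {A : Type v} [AddCommGroup A] [Module K A] [FiniteDimensional K A]
    (m n : ℕ) (As : Fin (m + 1) → Submodule K A) (hAs : Monotone As)
    (d : Fin (m + 1) → ℕ) (hd : ∀ i, Module.finrank K (As i) = d i)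
    (κ : Fin (m + 1) → Fin (n + 1) → ℕ) (hκd : ∀ i j, κ i j ≤ d i)
    (hκ : ∀ i i' j j', i ≤ i' → j ≤ j' → κ i j ≤ κ i' j') :
    FlagVar.IsIteratedBundle (FlagVar.doubleFlag As κ)
      ((List.finRange (n + 1)).map fun j =>
        FlagVar.schubertN K (fun i => κ i j) (FlagVar.nextCol κ d j)) ∧
    FlagVar.IsIteratedBundle (FlagVar.doubleFlag As κ)
      ((List.finRange (n + 1)).flatMap fun j =>
        (List.finRange (m + 1)).reverse.map fun i =>
          FlagVar.grassN K (FlagVar.delta κ i j)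
            (FlagVar.delta κ i j + FlagVar.epsilon κ d i j)) ∧
    (FlagVar.doubleFlag As κ).IsSmooth := by
  obtain ⟨W, hWm, hW⟩ := FlagVar.exists_grid_point hAs hd hκd hκ
  have e := FlagVar.isomorphic_doubleFlag hWm hW
  have hb := (FlagVar.isIteratedBundle_entries hWm).of_isomorphic e
  refine ⟨(FlagVar.isIteratedBundle_columns hWm).of_isomorphic e, hb, ?_⟩
  have : Infinite K := IsAlgClosed.instInfinite
  have hloc : FlagVar.LocallyAffineSpace (FlagVar.doubleFlag As κ) := by
    refine hb.locallyAffineSpace fun B hB => ?_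
    obtain ⟨j, -, hB⟩ := List.mem_flatMap.1 hB
    obtain ⟨i, -, rfl⟩ := List.mem_map.1 hB
    exact FlagVar.locallyAffineSpace_grass _
  exact hloc.isSmooth
    ((FlagVar.isVariety_pi_grass (FlagVar.isClosed_monoFamilies W _)).of_isomorphic e)
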